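/- Rows and sites are numbered from $0$, columns of matrices by $j=0,1,2,\dots$. A skew (semistandard) tableau $S$ of shape $\lambda/\mu$ has positive integer entries, weakly increasing along rows and strictly increasing down columns; its empty boxes (those of $\mu$) count as boxes filled with $0$. Its matrix $W=W(S)=(W_{i,j})_{i,j\ge 0}$ is $$W_{i,j}=\#\{0,1,\dots,j\text{'s in row } i\}-\#\{0,1,\dots,j+1\text{'s in row } i+1\}\ \ge 0,$$ with columns $W_j=(W_{0,j},W_{1,j},\dots)$. For a finite sequence $Q=(q_1,\dots,q_\ell)$ of rows, $P(Q)$ denotes the tableau $q_1\leftarrow q_2\leftarrow\cdots\leftarrow q_\ell$ obtained by row insertion; a tableau with $k$ rows is identified with $(P_0,\dots,P_{k-1})$, where $P_{p,i}$ is the number of $i$'s in row $p$. *Kicker-and-ball step.* For vectors $P=(P_i)_{i\ge0}$, $W=(W_i)_{i\ge0}$ of non-negative integers let $(P,W)\mapsto(P',W')$ be $$P'_{i+1}=(\min[P_{i+1},W_{i+1}]-\min[P_i,W_i])+P_i,\qquad W'_i=(\min[P_{i+1},W_{i+1}]-\min[P_i,W_i])+W_i,$$ with $P'_0=\min[P_0,W_0]$.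 *Column map.* $\{(P_0,\dots,P_{k-1}),W\}\mapsto\{(P'_0,\dots,P'_{k-1}),W'\}$ is obtained by applying this step with $P_{k-1}$ to $W$, then with $P_{k-2}$ to the resulting $W^{(1)}$, and so on down to $P_0$. *Map on matrices.* $\{P,W\}\mapsto\{P',W'\}$, for a matrix $W$ with columns $W_0,W_1,\dots$: put $P^{(0)}=P$ and let $\{P^{(j+1)},W'_j\}$ be the image of $\{P^{(j)},W_j\}$ under the column map; $W'$ has the columns $W'_j$, and $P'$ is the eventual value of $P^{(j)}$. *Tropical slide.* $\varphi_q:W\mapsto W^+$ is defined by $Q_0=e_q$ (the unit vector at place $q$) and $(Q_{j+1},W^+_j)=$ the image of $(Q_j,W_j)$ under the kicker-and-ball step. **Theorem.** Let $S$ be a skew tableau of shape $\lambda/\mu$, and let $Q=(q_1,\dots,q_\ell)$ be such that one can remove successively from $\mu$ corners in rows $q_1,\dots,q_\ell$. Then the jeu de taquin slides starting at the inside corners in rows $q_1,\dots,q_\ell$ can be carried out, in exactly one way. Let $S'$ be the resulting skew tableau (a rectification of $S$ if $\ell=|\mu|$), $Q'=(q'_1,\dots,q'_\ell)$ the rows where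 the slides end, $W=W(S)$ and $W'=W(S')$. 1. (Top arrow.) $W'=\varphi_{q_\ell}\circ\cdots\circ\varphi_{q_1}(W)$, and for all large $j$ the vector $Q^{(m)}_j$ occurring in the $m$-th of these tropical slides is $e_{q'_m}$, for $m=1,\dots,\ell$. 2. (Commutativity.) The map on matrices sends $\{P(Q),W\}$ to $\{P(Q'),W'\}$: its output matrix is $W'$, and $P^{(j)}=P(Q')$ for all large $j$. That is, the diagram $$\begin{array}{ccc}\{Q,W\}&\longmapsto&\{Q',W'\}\\ \downarrow&&\downarrow\\ \{P(Q),W\}&\longmapsto&\{P(Q'),W'\}\end{array}$$ with row insertion as vertical arrows commutes. 3. $S'$ and $P(Q')$ depend only on $S$ and $P(Q)$: two admissible sequences for $S$ with the same $P$-tableau lead to the same skew tableau and to the same $P$-tableau of end rows. 4. (The column map is the tropicalization of the relativistic Toda map.) Let $E_p(a)$ be the infinite matrix with diagonal $(1,\dots,1,a_p,a_{p+1},\dots)$, superdiagonal entries $0$ in rows $<p$ and $1$ in rows $\ge p$, and zeros elsewhere; let $F(v)$ be the infinite matrix with $1$'s on the diagonal, $-v_0,-v_1,\dots$ on the subdiagonal,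 and zeros elsewhere. For every $k\ge0$, all positive vectors $J_0,\dots,J_{k-1}$ with $J_{p,i}=1$ for $i<p$ and every positive vector $V$, the equation $$F(V')E_0(J_0)\cdots E_{k-1}(J_{k-1})=E_0(J'_0)\cdots E_{k-1}(J'_{k-1})F(V)$$ has exactly one positive solution $(J',V')$ with $J'_{p,i}=1$ for $i<p$. If such data depend on $\varepsilon>0$ and $-\varepsilon\log J_{p,i}(\varepsilon)\to P_{p,i}$, $-\varepsilon\log V_i(\varepsilon)\to W_i$ as $\varepsilon\downarrow0$, with non-negative integers $P_{p,i},W_i$, then $-\varepsilon\log J'_{p,i}(\varepsilon)\to P'_{p,i}$ and $-\varepsilon\log V'_i(\varepsilon)\to W'_i$, where $\{P',W'\}$ is the image of $\{P,W\}$ under the column map. -/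

import Mathlib

/-! Rows and columns of diagrams are numbered from `0`, with English conventions: the cell `(i, c)`
is in row `i`, column `c`.  Row insertion only uses the order of the inserted numbers, so numbering
the rows `0, 1, 2, …` instead of `1, 2, 3, …` lowers every entry of a `P`-tableau by one. -/

namespace JeuDeTaquin

/-- A skew semistandard tableau of shape `outer / inner` with positive integer entries.
The function `entry` is `0` on the empty boxes (those of `inner`) and outside `outer`. -/
@[ext]
structure SkewTableau where
  outer : YoungDiagram
  inner : YoungDiagram
  inner_le_outer : inner ≤ outer
  entry : ℕ → ℕ → ℕ
  entry_pos : ∀ i c, (i, c) ∈ outer → (i, c) ∉ inner → 0 < entry i c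
  entry_inner : ∀ i c, (i, c) ∈ inner → entry i c = 0
  entry_outside : ∀ i c, (i, c) ∉ outer → entry i c = 0
  row_weak : ∀ i c d, c < d → (i, c) ∉ inner → (i, d) ∈ outer → entry i c ≤ entry i d
  col_strict : ∀ i i' c, i < i' → (i, c) ∉ inner → (i', c) ∈ outer → entry i c < entry i' c

/-- The number of `0, 1, …, j`'s in row `i`, an empty box being regarded as a box with `0`. -/
def SkewTableau.rowCount (S : SkewTableau) (i j : ℕ) : ℕ :=
  ((Finset.range (S.outer.rowLen i)).filter (fun c => S.entry i c ≤ j)).card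

/-- The matrix `W` of a skew tableau, `W i j = #{0,…,j's in row i} - #{0,…,j+1's in row i+1}`.
The subtraction is never truncated, by `SkewTableau.rowCount_succ_le`. -/
def SkewTableau.wMatrix (S : SkewTableau) (i j : ℕ) : ℕ :=
  S.rowCount i j - S.rowCount (i + 1) (j + 1)

theorem SkewTableau.rowCount_succ_le (S : SkewTableau) (i j : ℕ) :
    S.rowCount (i + 1) (j + 1) ≤ S.rowCount i j := by
  unfold SkewTableau.rowCount
  refine Finset.card_le_card fun c hc => ?_
  simp only [Finset.mem_filter, Finset.mem_range, ← YoungDiagram.mem_iff_lt_rowLen] at hc ⊢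
  refine ⟨S.outer.up_left_mem (Nat.le_succ i) le_rfl hc.1, ?_⟩
  by_cases h : (i, c) ∈ S.inner
  · rw [S.entry_inner i c h]
    exact Nat.zero_le j
  · have := S.col_strict i (i + 1) c (Nat.lt_succ_self i) h hc.1
    omega

/-! ### Jeu de taquin slides -/

/-- `c` is a corner of `μ`: no box of `μ` lies directly below it or directly to its right. -/
def IsCorner (μ : YoungDiagram) (c : ℕ × ℕ) : Prop :=
  c ∈ μ ∧ (c.1 + 1, c.2) ∉ μ ∧ (c.1, c.2 + 1) ∉ μ

/-- Move the number at `src` to the hole `dst`, leaving `src` empty. -/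
def moveBox (f : ℕ → ℕ → ℕ) (src dst : ℕ × ℕ) : ℕ → ℕ → ℕ := fun i c =>
  if (i, c) = dst then f src.1 src.2 else if (i, c) = src then 0 else f i c

/-- One step of a slide, on pairs (filling, position of the hole); the value `0` means that there
is no box.  The smaller of the numbers below and to the right of the hole moves into the hole;
if the two are equal, the lower one moves. -/
inductive JdtStep : (ℕ → ℕ → ℕ) × (ℕ × ℕ) → (ℕ → ℕ → ℕ) × (ℕ × ℕ) → Prop
  | fromBelow (f : ℕ → ℕ → ℕ) (i c : ℕ) (hb : f (i + 1) c ≠ 0)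
      (h : f i (c + 1) = 0 ∨ f (i + 1) c ≤ f i (c + 1)) :
      JdtStep (f, (i, c)) (moveBox f (i + 1, c) (i, c), (i + 1, c))
  | fromRight (f : ℕ → ℕ → ℕ) (i c : ℕ) (hr : f i (c + 1) ≠ 0)
      (h : f (i + 1) c = 0 ∨ f i (c + 1) < f (i + 1) c) :
      JdtStep (f, (i, c)) (moveBox f (i, c + 1) (i, c), (i, c + 1))

/-- `Slide S k r S'`: the jeu de taquin slide of `S` that starts at the inside corner in row `k`
gives `S'`, and the hole ends up in row `r`. -/
def Slide (S : SkewTableau) (k r : ℕ) (S' : SkewTableau) : Prop :=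
  ∃ c d : ℕ, IsCorner S.inner (k, c) ∧
    Relation.ReflTransGen JdtStep (S.entry, (k, c)) (S'.entry, (r, d)) ∧
    S'.entry (r + 1) d = 0 ∧ S'.entry r (d + 1) = 0 ∧
    S'.inner.cells = S.inner.cells.erase (k, c) ∧
    S'.outer.cells = S.outer.cells.erase (r, d)

/-- `Slides S Q Q' S'`: the slides starting in the rows `Q = [Q₁, Q₂, …]` (in this order) are
possible from `S`, they end in the rows `Q' = [Q'₁, Q'₂, …]`, and they lead to `S'`. -/
inductive Slides : SkewTableau → List ℕ → List ℕ → SkewTableau → Prop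
  | nil (S : SkewTableau) : Slides S [] [] S
  | cons {S S₁ S' : SkewTableau} {k r : ℕ} {Q Q' : List ℕ} (h : Slide S k r S₁)
      (hs : Slides S₁ Q Q' S') : Slides S (k :: Q) (r :: Q') S'

/-- `IsStartSequence μ Q`: one can remove from `μ` successively a corner in row `Q₁`, then a corner
in row `Q₂` of what is left, and so on. -/
inductive IsStartSequence : YoungDiagram → List ℕ → Prop
  | nil (μ : YoungDiagram) : IsStartSequence μ []
  | cons {μ ν : YoungDiagram} {k c : ℕ} {Q : List ℕ} (h : IsCorner μ (k, c))
      (hν : ν.cells = μ.cells.erase (k, c)) (hQ : IsStartSequence ν Q) :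
      IsStartSequence μ (k :: Q)

/-! ### Row insertion -/

/-- Insert `t` into a row: `t` replaces the leftmost entry greater than `t`, which is bumped,
and is put at the end of the row if there is no such entry. -/
def rowBump (t : ℕ) : List ℕ → List ℕ × Option ℕ
  | [] => ([t], none)
  | a :: R => if t < a then (t :: R, some a) else (a :: (rowBump t R).1, (rowBump t R).2)

/-- The row insertion `T ← t` for a tableau given by its list of rows. -/
def rowInsert : List (List ℕ) → ℕ → List (List ℕ)
  | [], t => [[t]]
  | R :: T, t =>
    match rowBump t R with
    | (R', none) => R' :: T
    | (R', some b) => R' :: rowInsert T b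

/-- The `P`-tableau `Q₁ ← Q₂ ← ⋯ ← Q_ℓ` of a sequence. -/
def pTableau (Q : List ℕ) : List (List ℕ) := Q.foldl rowInsert []

/-- `mult T p i` is the number of `i`'s in row `p` of `T`. -/
def mult (T : List (List ℕ)) (p i : ℕ) : ℕ := (T.getD p []).count i

/-! ### The kicker-and-ball model

A vector `P` puts `P i` kickers and a vector `W` puts `W i` balls at site `i`.  At site `i`,
`min (P i) (W i)` kickers kick one ball each to site `i - 1` (out of the system if `i = 0`) and stay;
the other kickers move to site `i + 1`.  That is, with `P (-1) = 0` and `W (-1) = ∞`,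
`P' (i+1) = (min (P (i+1)) (W (i+1)) - min (P i) (W i)) + P i` and
`W' i = (min (P (i+1)) (W (i+1)) - min (P i) (W i)) + W i`. -/

def kickers (P W : ℕ → ℕ) : ℕ → ℕ
  | 0 => min (P 0) (W 0)
  | i + 1 => min (P (i + 1)) (W (i + 1)) + (P i - min (P i) (W i))

def balls (P W : ℕ → ℕ) (i : ℕ) : ℕ :=
  W i - min (P i) (W i) + min (P (i + 1)) (W (i + 1))

/-- The vectors `Q_0, Q_1, Q_2, …` produced from a matrix `W` (with columns `W_0, W_1, …`)
and `Q_0 = (0, …, 0, 1, 0, …)` (the `1` at place `k`). -/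
def slideQ (k : ℕ) (W : ℕ → ℕ → ℕ) : ℕ → ℕ → ℕ
  | 0 => Pi.single k 1
  | j + 1 => kickers (slideQ k W j) (fun i => W i j)

/-- The tropical slide `φ_k`. -/
def slideW (k : ℕ) (W : ℕ → ℕ → ℕ) : ℕ → ℕ → ℕ := fun i j =>
  balls (slideQ k W j) (fun a => W a j) i

/-- The matrix at the bottom of the rectification diagram with left column `Q`, top row `W`. -/
def rectW : List ℕ → (ℕ → ℕ → ℕ) → ℕ → ℕ → ℕ
  | [], W => W
  | k :: Q, W => rectW Q (slideW k W)

/-- The vectors `Q^{(1)}_j, Q^{(2)}_j, …` at position `j` of the rectification diagram with left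
column `Q` and top row `W`. -/
def rectQ : List ℕ → (ℕ → ℕ → ℕ) → ℕ → List (ℕ → ℕ)
  | [], _, _ => []
  | k :: Q, W, j => slideQ k W j :: rectQ Q (slideW k W) j

/-! ### The tropical map `{(P_0, …, P_{k-1}), W} ↦ {(P'_0, …, P'_{k-1}), W'}`

The vectors `P_{k-1}, P_{k-2}, …, P_0` act one after the other on `W`. -/

/-- The output `W'` for the vectors `P 0, …, P (k-1)` and the input `W`. -/
def colBalls (P : ℕ → ℕ → ℕ) : ℕ → (ℕ → ℕ) → ℕ → ℕ
  | 0, W => W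
  | k + 1, W => colBalls P k (balls (P k) W)

/-- The output vectors `P' 0, …, P' (k-1)`; the vectors `P p` with `p ≥ k` are left alone. -/
def colKickers (P : ℕ → ℕ → ℕ) : ℕ → (ℕ → ℕ) → ℕ → ℕ → ℕ
  | 0, _ => P
  | k + 1, W => Function.update (colKickers P k (balls (P k) W)) k (kickers (P k) W)

/-- The `k`-row array after the columns `W_0, …, W_{j-1}` of `W` have acted on the array `P`. -/
def arrayP (k : ℕ) (P W : ℕ → ℕ → ℕ) : ℕ → ℕ → ℕ → ℕ
  | 0 => P
  | j + 1 => colKickers (arrayP k P W j) k (fun i => W i j)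

/-- The matrix produced from `W` by the same process. -/
def arrayW (k : ℕ) (P W : ℕ → ℕ → ℕ) : ℕ → ℕ → ℕ := fun i j =>
  colBalls (arrayP k P W j) k (fun a => W a j) i

/-! ### The rational map and its tropicalization -/

/-- The infinite matrix `E_p(a) = Id_p ⊕ E(a_p, a_{p+1}, …)`, where `E` has its argument on the
diagonal and `1`'s on the superdiagonal, as an operator on column vectors. -/
def matE (p : ℕ) (a : ℕ → ℝ) : Module.End ℝ (ℕ → ℝ) where
  toFun x i := if i < p then x i else a i * x i + x (i + 1)
  map_add' x y := by
    funext i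
    by_cases h : i < p
    · simp [h]
    · simp only [h, if_false, Pi.add_apply]
      ring
  map_smul' r x := by
    funext i
    by_cases h : i < p
    · simp [h]
    · simp only [h, if_false, Pi.smul_apply, smul_eq_mul, RingHom.id_apply]
      ring

/-- The infinite matrix `F(v)` with `1`'s on the diagonal and `-v_0, -v_1, …` on the subdiagonal,
as an operator on column vectors. -/
def matF (v : ℕ → ℝ) : Module.End ℝ (ℕ → ℝ) where
  toFun x i := if i = 0 then x i else x i - v (i - 1) * x (i - 1)
  map_add' x y := by
    funext i
    by_cases h : i = 0
    · simp [h]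
    · simp only [h, if_false, Pi.add_apply]
      ring
  map_smul' r x := by
    funext i
    by_cases h : i = 0
    · simp [h]
    · simp only [h, if_false, Pi.smul_apply, smul_eq_mul, RingHom.id_apply]
      ring

/-- Positive data `{J, V}`; the vector `J p` has the form `(1, …, 1, J_{p,p}, J_{p,p+1}, …)`. -/
def IsPosData {k : ℕ} (J : Fin k → ℕ → ℝ) (V : ℕ → ℝ) : Prop :=
  (∀ p i, 0 < J p i) ∧ (∀ (p : Fin k) (i : ℕ), i < p → J p i = 1) ∧ ∀ i, 0 < V i

/-- The matrix equation `F(V') E_0(J_0) ⋯ E_{k-1}(J_{k-1}) = E_0(J'_0) ⋯ E_{k-1}(J'_{k-1}) F(V)`. -/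
def TodaEquation {k : ℕ} (J : Fin k → ℕ → ℝ) (V : ℕ → ℝ) (J' : Fin k → ℕ → ℝ) (V' : ℕ → ℝ) :
    Prop :=
  matF V' * (List.ofFn fun p : Fin k => matE p (J p)).prod =
    (List.ofFn fun p : Fin k => matE p (J' p)).prod * matF V

/-- The positive function `f` has the ultradiscretization `A = - lim_{ε ↓ 0} ε log f(ε)`. -/
def HasTrop (f : ℝ → ℝ) (A : ℝ) : Prop :=
  Filter.Tendsto (fun ε => -(ε * Real.log (f ε))) (nhdsWithin 0 (Set.Ioi 0)) (nhds A)

end JeuDeTaquin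

namespace JeuDeTaquin

/-! ### Row counts determine a tableau -/

/-! A slide is followed one number at a time rather than one box at a time. After the numbers `1, …,
j` have been moved, the hole lies in the last column of the segment formed by the boxes with entry
at most `j` in its row `i`. If `W i j = 0`, a `j + 1` lies directly below and the hole drops to row
`i + 1`; otherwise it runs to the right through the `j + 1`'s of row `i`. This is the motion of a
single kicker (`SkewTableau.hole_succ`). On row counts the slide only subtracts `1` in the row of
the hole, which turns `W` into its tropical slide (`SkewTableau.wMatrix_slideResult`). The result is
built from its row counts and then shown to be reached by the box moves
(`SkewTableau.slide_slideResult`); since these are deterministic, nothing else can be reached.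

For several slides the diagram is read by columns: column `j` of `W` is acted on by the word of
current hole rows, one kicker per letter (`holeRows_succ`). The heart of the proof is that row
insertion intertwines the action of a word with that of its `P`-tableau, whose rows act from the
last to the first (`tabKickers_pTableau`). Inserting letter by letter and row by row, this reduces
to one row: if `q` bumps `b` out of `R`, then `R` followed by `q` acts like `b` followed by the new
row (`rowBump_wordKickers_some`). Kickers at different sites commute with one exception
(`letter_comm`), and the exception is treated by hand. A weakly increasing word acts like a single
kicker-and-ball step (`kickers_count`), so the action of a tableau is the column map. The tableau
thus evolves on its own, and since `W` determines the skew tableau (`SkewTableau.ext_wMatrix`), the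
results depend on `Q` only through its `P`-tableau.

For the rational map, `F(V)` is moved leftwards through the factors by explicit subtraction-free
formulas (`matF_mul_matE`). Positivity and triangularity make the solution unique
(`TodaEquation.unique`), and the formulas tropicalize term by term, sums becoming minima
(`HasTrop.add`). -/

theorem mem_iff_lt_card_of_lower {s : Finset ℕ} (h : ∀ a b, a < b → b ∈ s → a ∈ s) (c : ℕ) :
    c ∈ s ↔ c < s.card := by
  constructor
  · intro hc
    have : Finset.range (c + 1) ⊆ s := by
      intro a ha
      rcases Nat.lt_succ_iff_lt_or_eq.1 (Finset.mem_range.1 ha) with h1 | h1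
      · exact h a c h1 hc
      · exact h1 ▸ hc
    simpa using Finset.card_le_card this
  · intro hc
    by_contra hn
    have : s ⊆ Finset.range c := by
      intro a ha
      rw [Finset.mem_range]
      by_contra hac
      rcases Nat.lt_or_ge c a with h1 | h1
      · exact hn (h c a h1 ha)
      · exact hn ((by omega : a = c) ▸ ha)
    have := Finset.card_le_card this
    simp only [Finset.card_range] at this
    omega

namespace SkewTableau

/-- Rows increase weakly and empty boxes carry `0`, so the boxes with entry at most `j` form an
initial segment of the row. Comparisons of entries thereby become inequalities between segment
lengths. -/
theorem lt_rowCount (S : SkewTableau) (i c j : ℕ) :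
    c < S.rowCount i j ↔ (i, c) ∈ S.outer ∧ S.entry i c ≤ j := by
  unfold rowCount
  rw [← mem_iff_lt_card_of_lower]
  · simp [YoungDiagram.mem_iff_lt_rowLen]
  · intro a b hab hb
    simp only [Finset.mem_filter, Finset.mem_range, ← YoungDiagram.mem_iff_lt_rowLen] at hb ⊢
    refine ⟨S.outer.up_left_mem le_rfl hab.le hb.1, ?_⟩
    by_cases h : (i, a) ∈ S.inner
    · simp [S.entry_inner i a h]
    · exact (S.row_weak i a b hab h hb.1).trans hb.2

theorem mem_inner_iff (S : SkewTableau) (i c : ℕ) : (i, c) ∈ S.inner ↔ c < S.rowCount i 0 := by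
  rw [lt_rowCount]
  constructor
  · intro h
    exact ⟨S.inner_le_outer h, (S.entry_inner i c h).le⟩
  · rintro ⟨h1, h2⟩
    by_contra h3
    have := S.entry_pos i c h1 h3
    omega

theorem rowCount_mono (S : SkewTableau) (i : ℕ) : Monotone (S.rowCount i) := by
  intro j j' h
  refine le_of_forall_lt fun c hc => ?_
  rw [lt_rowCount] at hc ⊢
  exact ⟨hc.1, hc.2.trans h⟩

/-- A bound for the entries of a tableau. -/
def bound (S : SkewTableau) : ℕ := S.outer.cells.sup fun x => S.entry x.1 x.2

theorem entry_le_bound (S : SkewTableau) (i c : ℕ) : S.entry i c ≤ S.bound := by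
  by_cases h : (i, c) ∈ S.outer
  · exact Finset.le_sup (f := fun x : ℕ × ℕ => S.entry x.1 x.2)
      ((YoungDiagram.mem_cells (c := (i, c))).2 h)
  · simp [S.entry_outside i c h]

theorem mem_outer_iff (S : SkewTableau) {N : ℕ} (hN : S.bound ≤ N) (i c : ℕ) :
    (i, c) ∈ S.outer ↔ c < S.rowCount i N := by
  rw [lt_rowCount]
  exact ⟨fun h => ⟨h, (S.entry_le_bound i c).trans hN⟩, fun h => h.1⟩

theorem rowCount_eq_of_bound_le (S : SkewTableau) {N : ℕ} (hN : S.bound ≤ N) (i : ℕ) :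
    S.rowCount i N = S.rowCount i S.bound :=
  eq_of_forall_lt_iff fun c => by rw [← S.mem_outer_iff hN, ← S.mem_outer_iff le_rfl]

theorem rowCount_eq_zero (S : SkewTableau) {i : ℕ} (hi : S.outer.colLen 0 ≤ i) (j : ℕ) :
    S.rowCount i j = 0 := by
  by_contra h
  have h1 := ((S.lt_rowCount i 0 j).1 (Nat.pos_of_ne_zero h)).1
  rw [YoungDiagram.mem_iff_lt_colLen] at h1
  omega

theorem wMatrix_add (S : SkewTableau) (i j : ℕ) :
    S.wMatrix i j + S.rowCount (i + 1) (j + 1) = S.rowCount i j :=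
  Nat.sub_add_cancel (S.rowCount_succ_le i j)

theorem ext_rowCount {S T : SkewTableau} (h : S.rowCount = T.rowCount) : S = T := by
  have ho : S.outer = T.outer := by
    ext ⟨i, c⟩
    rw [YoungDiagram.mem_cells, YoungDiagram.mem_cells,
      S.mem_outer_iff (le_max_left S.bound T.bound), T.mem_outer_iff (le_max_right S.bound T.bound), h]
  refine SkewTableau.ext ho ?_ ?_
  · ext ⟨i, c⟩
    rw [YoungDiagram.mem_cells, YoungDiagram.mem_cells, mem_inner_iff, mem_inner_iff, h]
  · funext i c
    by_cases hc : (i, c) ∈ S.outer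
    · refine eq_of_forall_ge_iff fun j => ?_
      have h1 := S.lt_rowCount i c j
      have h2 := T.lt_rowCount i c j
      rw [h] at h1
      rw [← ho] at h2
      simp only [hc, true_and] at h1 h2
      rw [← h1, ← h2]
    · rw [S.entry_outside i c hc, T.entry_outside i c (ho ▸ hc)]

/-- Row counts are recovered from `W` by summing along a diagonal, starting below the diagrams,
where all counts vanish. -/
theorem ext_wMatrix {S T : SkewTableau} (h : S.wMatrix = T.wMatrix) : S = T := by
  apply ext_rowCount
  have key : ∀ n i j, max (S.outer.colLen 0) (T.outer.colLen 0) ≤ i + n →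
      S.rowCount i j = T.rowCount i j := by
    intro n
    induction n with
    | zero =>
      intro i j hi
      rw [S.rowCount_eq_zero (by omega), T.rowCount_eq_zero (by omega)]
    | succ n ih =>
      intro i j hi
      rw [← S.wMatrix_add i j, ← T.wMatrix_add i j, h, ih (i + 1) (j + 1) (by omega)]
  funext i j
  exact key _ i j (Nat.le_add_left _ i)

/-! ### Constructing a tableau from its row counts -/

section OfCounts

variable (outer inner : YoungDiagram) (R : ℕ → ℕ → ℕ) (N : ℕ)

/-- The cardinality is the least `j` with `c < R i j`, that is, the entry that the box `(i, c)` must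
receive. -/
theorem card_filter_le_iff (hR : ∀ i, Monotone (R i)) {i c j : ℕ} (hc : c < R i N) :
    ((Finset.range N).filter fun j => R i j ≤ c).card ≤ j ↔ c < R i j := by
  rw [← not_lt, ← mem_iff_lt_card_of_lower]
  · simp only [Finset.mem_filter, Finset.mem_range, not_and, not_le]
    refine ⟨fun h => ?_, fun h _ => h⟩
    by_cases hj : j < N
    · exact h hj
    · exact hc.trans_le (hR i (not_lt.1 hj))
  · intro a b hab hb
    simp only [Finset.mem_filter, Finset.mem_range] at hb ⊢
    exact ⟨hab.trans hb.1, (hR i hab.le).trans hb.2⟩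

theorem count_succ_le_of_lt (hR : ∀ i, Monotone (R i)) (hI : ∀ i j, R (i + 1) (j + 1) ≤ R i j)
    {i i' : ℕ} (h : i < i') (j : ℕ) : R i' (j + 1) ≤ R i j := by
  induction i', h using Nat.le_induction with
  | base => exact hI i j
  | succ i' h ih => exact ((hI i' j).trans (hR i' (Nat.le_succ j))).trans ih

open Classical in
/-- The skew tableau with given row counts. -/
noncomputable def ofCounts (hR : ∀ i, Monotone (R i)) (hI : ∀ i j, R (i + 1) (j + 1) ≤ R i j)
    (ho : ∀ i c, (i, c) ∈ outer ↔ c < R i N) (hi : ∀ i c, (i, c) ∈ inner ↔ c < R i 0) :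
    SkewTableau where
  outer := outer
  inner := inner
  inner_le_outer := by
    rintro ⟨i, c⟩ h
    have h1 := (hi i c).1 h
    exact (ho i c).2 (h1.trans_le (hR i (Nat.zero_le N)))
  entry i c := if (i, c) ∈ outer then ((Finset.range N).filter fun j => R i j ≤ c).card else 0
  entry_pos i c h1 h2 := by
    rw [if_pos h1, Nat.pos_iff_ne_zero]
    intro h
    exact h2 ((hi i c).2 ((card_filter_le_iff R N hR ((ho i c).1 h1)).1 h.le))
  entry_inner i c h := by
    have h1 := (hi i c).1 h
    have h2 := h1.trans_le (hR i (Nat.zero_le N))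
    rw [if_pos ((ho i c).2 h2)]
    exact Nat.le_zero.1 ((card_filter_le_iff R N hR h2).2 h1)
  entry_outside i c h := if_neg h
  row_weak i c d hcd _ hd := by
    have hd' := (ho i d).1 hd
    rw [if_pos hd, if_pos ((ho i c).2 (hcd.trans hd')), card_filter_le_iff R N hR (hcd.trans hd')]
    exact hcd.trans ((card_filter_le_iff R N hR hd').1 le_rfl)
  col_strict i i' c h hc hc' := by
    have h1 := (ho i' c).1 hc'
    have h2 := (card_filter_le_iff R N hR h1).1 le_rfl
    have h3 : (i, c) ∈ outer := outer.up_left_mem h.le le_rfl hc'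
    rw [if_pos h3, if_pos hc']
    generalize ((Finset.range N).filter fun j => R i' j ≤ c).card = m at h2
    rcases m with _ | m
    -- An entry `0` in row `i'` would make the box above it empty as well: `c < R i' 0 ≤ R i' 1 ≤ R
    -- i 0`.
    · exact absurd ((hi i c).2 (h2.trans_le ((hR i' (Nat.zero_le 1)).trans
        (count_succ_le_of_lt R hR hI h 0)))) hc
    · exact Nat.lt_succ_of_le ((card_filter_le_iff R N hR ((ho i c).1 h3)).2
        (h2.trans_le (count_succ_le_of_lt R hR hI h m)))

theorem rowCount_ofCounts (hR : ∀ i, Monotone (R i)) (hI : ∀ i j, R (i + 1) (j + 1) ≤ R i j)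
    (ho : ∀ i c, (i, c) ∈ outer ↔ c < R i N) (hi : ∀ i c, (i, c) ∈ inner ↔ c < R i 0)
    (hN : ∀ i j, R i j ≤ R i N) :
    (ofCounts outer inner R N hR hI ho hi).rowCount = R := by
  funext i j
  refine eq_of_forall_lt_iff fun c => ?_
  rw [lt_rowCount]
  by_cases hc : (i, c) ∈ outer
  · have : (ofCounts outer inner R N hR hI ho hi).entry i c =
      ((Finset.range N).filter fun j => R i j ≤ c).card := if_pos hc
    rw [this, card_filter_le_iff R N hR ((ho i c).1 hc)]
    exact ⟨fun h => h.2, fun h => ⟨hc, h⟩⟩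
  · exact ⟨fun h => absurd h.1 hc, fun h => absurd ((ho i c).2 (h.trans_le (hN i j))) hc⟩

end OfCounts

theorem entry_eq_of_rowCount (S : SkewTableau) {i c j : ℕ} (h1 : S.rowCount i j ≤ c)
    (h2 : c < S.rowCount i (j + 1)) : S.entry i c = j + 1 := by
  have h3 := (S.lt_rowCount i c (j + 1)).1 h2
  have h4 := mt (S.lt_rowCount i c j).2 (not_lt.2 h1)
  have : ¬ S.entry i c ≤ j := fun h => h4 ⟨h3.1, h⟩
  omega

theorem entry_of_rowCount_le (S : SkewTableau) {i c j : ℕ} (h : S.rowCount i j ≤ c) :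
    S.entry i c = 0 ∨ j < S.entry i c := by
  by_cases hc : (i, c) ∈ S.outer
  · right
    have h4 := mt (S.lt_rowCount i c j).2 (not_lt.2 h)
    by_contra h5
    exact h4 ⟨hc, not_lt.1 h5⟩
  · exact Or.inl (S.entry_outside i c hc)

end SkewTableau

/-! ### One slide -/

/-- A kicker at site `a` stays there if it finds a ball, and moves on otherwise. -/
def letterStep (w : ℕ → ℕ) (a : ℕ) : ℕ := if w a = 0 then a + 1 else a

theorem kickers_single (a : ℕ) (w : ℕ → ℕ) :
    kickers (Pi.single a 1) w = Pi.single (letterStep w a) 1 := by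
  funext i
  unfold letterStep
  rcases i with _ | i
  · simp only [kickers, Pi.single_apply]
    by_cases h1 : 0 = a
    · subst h1
      by_cases h2 : w 0 = 0
      · simp [h2]
      · simp [h2]; omega
    · by_cases h3 : w a = 0 <;> simp [h1, h3]
  · simp only [kickers, Pi.single_apply]
    by_cases h1 : i + 1 = a
    · subst h1
      by_cases h2 : w (i + 1) = 0
      · simp [h2]
      · simp [h2]; omega
    · by_cases h2 : i = a
      · subst h2
        by_cases h3 : w i = 0
        · simp [h3]
        · simp [h3]; omega
      · have h4 : ¬ i + 1 = a + 1 := by omega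
        by_cases h3 : w a = 0 <;> simp [h1, h2, h3]

theorem balls_single (a : ℕ) (w : ℕ → ℕ) (i : ℕ) :
    balls (Pi.single a 1) w i =
      if w a = 0 then w i else (if i = a then w i - 1 else w i) + if i + 1 = a then 1 else 0 := by
  simp only [balls, Pi.single_apply]
  by_cases h1 : i + 1 = a
  · subst h1
    by_cases h2 : w (i + 1) = 0
    · simp [h2]
    · simp [h2]; omega
  · by_cases h2 : i = a
    · subst h2
      by_cases h3 : w i = 0
      · simp [h3]
      · simp [h3]; omega
    · simp [h1, h2]

/-- The row of the hole of a slide after the numbers `1, …, j` have been moved. -/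
def holeRow (k : ℕ) (W : ℕ → ℕ → ℕ) : ℕ → ℕ
  | 0 => k
  | j + 1 => letterStep (fun i => W i j) (holeRow k W j)

theorem slideQ_eq (k : ℕ) (W : ℕ → ℕ → ℕ) (j : ℕ) :
    slideQ k W j = Pi.single (holeRow k W j) 1 := by
  induction j with
  | zero => rfl
  | succ j ih => rw [slideQ, ih, kickers_single, holeRow]

/-- The Young diagram without a corner. -/
def eraseCorner (μ : YoungDiagram) (x : ℕ × ℕ) (h : IsCorner μ x) : YoungDiagram where
  cells := μ.cells.erase x
  isLowerSet := by
    rintro ⟨i, c⟩ ⟨i', c'⟩ ⟨hi, hc⟩ hm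
    obtain ⟨a, b⟩ := x
    simp only [IsCorner] at h hi hc
    simp only [Finset.coe_erase, Set.mem_sdiff, Finset.mem_coe, YoungDiagram.mem_cells,
      Set.mem_singleton_iff, Prod.mk.injEq] at hm ⊢
    refine ⟨μ.up_left_mem hi hc hm.1, ?_⟩
    rintro ⟨rfl, rfl⟩
    rcases hi.lt_or_eq with h1 | rfl
    · exact h.2.1 (μ.up_left_mem h1 hc hm.1)
    · rcases hc.lt_or_eq with h1 | rfl
      · exact h.2.2 (μ.up_left_mem hi h1 hm.1)
      · exact hm.2 ⟨rfl, rfl⟩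

theorem mem_eraseCorner (μ : YoungDiagram) (x : ℕ × ℕ) (h : IsCorner μ x) (y : ℕ × ℕ) :
    y ∈ eraseCorner μ x h ↔ y ≠ x ∧ y ∈ μ := by
  rw [← YoungDiagram.mem_cells]
  exact Finset.mem_erase.trans (by rw [YoungDiagram.mem_cells])

namespace SkewTableau

theorem isCorner_inner_iff (S : SkewTableau) (k c : ℕ) :
    IsCorner S.inner (k, c) ↔ S.rowCount k 0 = c + 1 ∧ S.rowCount (k + 1) 0 ≤ c := by
  simp only [IsCorner, mem_inner_iff]
  omega

theorem isCorner_outer_iff (S : SkewTableau) {N : ℕ} (hN : S.bound ≤ N) (k c : ℕ) :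
    IsCorner S.outer (k, c) ↔ S.rowCount k N = c + 1 ∧ S.rowCount (k + 1) N ≤ c := by
  simp only [IsCorner, S.mem_outer_iff hN]
  omega

/-- The row of the hole in the slide of `S` that starts in row `k`. -/
def hole (S : SkewTableau) (k j : ℕ) : ℕ := holeRow k S.wMatrix j

/-- The row counts of the result of the slide of `S` that starts in row `k`. -/
def slideCount (S : SkewTableau) (k i j : ℕ) : ℕ :=
  S.rowCount i j - if S.hole k j = i then 1 else 0

/-- The hole is thought of in column `S.rowCount (S.hole k j) j - 1`. A vanishing `W` says that the
segment of entries at most `j + 1` in the next row ends in this same column, so that the hole can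
drop. -/
theorem hole_succ (S : SkewTableau) (k j : ℕ) :
    (S.rowCount (S.hole k j + 1) (j + 1) = S.rowCount (S.hole k j) j ∧
      S.wMatrix (S.hole k j) j = 0 ∧ S.hole k (j + 1) = S.hole k j + 1) ∨
    (S.rowCount (S.hole k j + 1) (j + 1) < S.rowCount (S.hole k j) j ∧
      S.wMatrix (S.hole k j) j ≠ 0 ∧ S.hole k (j + 1) = S.hole k j) := by
  have h := S.wMatrix_add (S.hole k j) j
  have h2 : S.hole k (j + 1) = letterStep (fun i => S.wMatrix i j) (S.hole k j) := rfl
  unfold letterStep at h2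
  by_cases h3 : S.wMatrix (S.hole k j) j = 0
  · rw [if_pos h3] at h2
    exact Or.inl ⟨by omega, h3, h2⟩
  · rw [if_neg h3] at h2
    exact Or.inr ⟨by omega, h3, h2⟩

section Slide

variable (S : SkewTableau) {k : ℕ} (hk : S.rowCount (k + 1) 0 < S.rowCount k 0)
include hk

/-- The invariant of a slide: the box under the hole does not hold a number at most `j`. It holds
initially because the hole is an inside corner. It also guarantees that the subtraction in
`slideCount` is never truncated. -/
theorem rowCount_hole_succ_lt (j : ℕ) :
    S.rowCount (S.hole k j + 1) j < S.rowCount (S.hole k j) j := by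
  induction j with
  | zero => exact hk
  | succ j ih =>
    rcases S.hole_succ k j with ⟨h1, -, h2⟩ | ⟨h1, -, h2⟩
    · rw [h2, h1]
      exact (S.rowCount_succ_le _ j).trans_lt ih
    · rw [h2]
      exact h1.trans_le (S.rowCount_mono _ (Nat.le_add_right j 1))

theorem slideCount_mono (i : ℕ) : Monotone (S.slideCount k i) := by
  refine monotone_nat_of_le_succ fun j => ?_
  have h0 := S.rowCount_mono i (Nat.le_add_right j 1)
  have h3 := S.rowCount_hole_succ_lt hk j
  unfold slideCount
  rcases S.hole_succ k j with ⟨h1, -, h2⟩ | ⟨h1, -, h2⟩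
  · rw [h2]
    by_cases h4 : S.hole k j + 1 = i
    · subst h4
      rw [if_neg (by omega), if_pos rfl]
      omega
    · rw [if_neg h4]
      exact (Nat.sub_le _ _).trans h0
  · rw [h2]
    split_ifs <;> omega

/-- If the hole drops, both counts in the affected difference lose `1` and `W` is unchanged. If it
stays in its row, the difference for that row loses `1` and the one for the row above, if any, gains
`1`: a ball is kicked up by one site. -/
theorem wMatrix_slide (i j : ℕ) :
    slideW k S.wMatrix i j + S.slideCount k (i + 1) (j + 1) = S.slideCount k i j := by
  have h0 := S.wMatrix_add i j
  have h3 := S.rowCount_hole_succ_lt hk j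
  have h5 := S.rowCount_hole_succ_lt hk (j + 1)
  unfold slideCount slideW
  rw [slideQ_eq, balls_single]
  change (if S.wMatrix (S.hole k j) j = 0 then _ else (if i = S.hole k j then _ else _) +
    if i + 1 = S.hole k j then _ else _) + _ = _
  rcases S.hole_succ k j with ⟨h1, h4, h2⟩ | ⟨h1, h4, h2⟩
  · rw [if_pos h4, h2]
    rw [h2] at h5
    by_cases h6 : S.hole k j = i
    · subst h6
      rw [if_pos rfl, if_pos rfl]
      omega
    · rw [if_neg h6, if_neg (by omega)]
      omega
  · rw [if_neg h4, h2]
    rw [h2] at h5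
    by_cases h6 : S.hole k j = i
    · subst h6
      rw [if_pos rfl, if_pos rfl, if_neg (by omega), if_neg (by omega)]
      omega
    · rw [if_neg (Ne.symm h6), if_neg h6]
      by_cases h7 : i + 1 = S.hole k j
      · rw [if_pos h7, if_pos h7.symm]
        rw [← h7] at h5
        omega
      · rw [if_neg h7, if_neg (Ne.symm h7)]
        omega

theorem slideCount_succ_le (i j : ℕ) : S.slideCount k (i + 1) (j + 1) ≤ S.slideCount k i j :=
  (Nat.le_add_left _ _).trans (S.wMatrix_slide hk i j).le

/-- Beyond the largest entry the row counts are constant in `j`, and dropping would then contradict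
the invariant. -/
theorem hole_eq_of_bound_le {j : ℕ} (hj : S.bound ≤ j) : S.hole k j = S.hole k S.bound := by
  induction j, hj using Nat.le_induction with
  | base => rfl
  | succ j hj ih =>
    have h := S.rowCount_hole_succ_lt hk j
    rcases S.hole_succ k j with ⟨h1, -, h2⟩ | ⟨h1, -, h2⟩
    · rw [S.rowCount_eq_of_bound_le (by omega), ← S.rowCount_eq_of_bound_le hj] at h1
      omega
    · rw [h2, ih]

theorem isCorner_inner : IsCorner S.inner (k, S.rowCount k 0 - 1) := by
  rw [isCorner_inner_iff]
  omega

theorem isCorner_outer : IsCorner S.outer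
    (S.hole k S.bound, S.rowCount (S.hole k S.bound) S.bound - 1) := by
  rw [isCorner_outer_iff S le_rfl]
  have := S.rowCount_hole_succ_lt hk S.bound
  omega

theorem slideCount_le_bound (i j : ℕ) : S.slideCount k i j ≤ S.slideCount k i S.bound := by
  rcases le_total j S.bound with h | h
  · exact S.slideCount_mono hk i h
  · unfold slideCount
    rw [S.hole_eq_of_bound_le hk h, S.rowCount_eq_of_bound_le h]

/-- The result of the slide of `S` that starts in row `k`. -/
noncomputable def slideResult : SkewTableau :=
  ofCounts (eraseCorner S.outer _ (S.isCorner_outer hk)) (eraseCorner S.inner _ (S.isCorner_inner hk))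
    (S.slideCount k) S.bound (S.slideCount_mono hk) (S.slideCount_succ_le hk)
    (by
      intro i c
      rw [mem_eraseCorner, S.mem_outer_iff le_rfl, slideCount, Ne, Prod.mk.injEq]
      have := S.rowCount_hole_succ_lt hk S.bound
      by_cases h : S.hole k S.bound = i
      · subst h
        rw [if_pos rfl]
        omega
      · rw [if_neg h]
        omega)
    (by
      intro i c
      rw [mem_eraseCorner, S.mem_inner_iff, slideCount, Ne, Prod.mk.injEq]
      change _ ↔ c < S.rowCount i 0 - if k = i then 1 else 0
      by_cases h : k = i
      · subst h
        rw [if_pos rfl]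
        omega
      · rw [if_neg h]
        omega)

theorem rowCount_slideResult : (S.slideResult hk).rowCount = S.slideCount k :=
  rowCount_ofCounts _ _ _ _ _ _ _ _ (S.slideCount_le_bound hk)

theorem wMatrix_slideResult : (S.slideResult hk).wMatrix = slideW k S.wMatrix := by
  funext i j
  have h1 := S.wMatrix_slide hk i j
  have h2 := (S.slideResult hk).wMatrix_add i j
  rw [rowCount_slideResult] at h2
  omega

end Slide

end SkewTableau

/-! ### Realizing the slide by elementary moves -/

theorem moveBox_self (f : ℕ → ℕ → ℕ) (x : ℕ × ℕ) : moveBox f x x = f := by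
  funext i c
  unfold moveBox
  split_ifs with h
  · rw [← h]
  · rfl

/-- A run of steps to the right over equal numbers. -/
theorem jdt_run_right (f : ℕ → ℕ → ℕ) (i c v : ℕ) (hv : v ≠ 0) (m : ℕ)
    (h1 : ∀ t < m, f i (c + 1 + t) = v)
    (h2 : ∀ t < m, f (i + 1) (c + t) = 0 ∨ v < f (i + 1) (c + t)) :
    Relation.ReflTransGen JdtStep (f, (i, c)) (moveBox f (i, c + m) (i, c), (i, c + m)) := by
  induction m with
  | zero => rw [Nat.add_zero, moveBox_self]
  | succ m ih =>
    refine (ih (fun t ht => h1 t (by omega)) (fun t ht => h2 t (by omega))).tail ?_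
    have e1 : moveBox f (i, c + m) (i, c) i (c + m + 1) = v := by
      have h3 : ¬ c + 1 + m = c := by omega
      simp [moveBox, show c + m + 1 = c + 1 + m by omega, h3, h1 m (by omega)]
    have e2 : moveBox f (i, c + m) (i, c) (i + 1) (c + m) = f (i + 1) (c + m) := by
      simp [moveBox]
    -- Because the numbers in the run are equal, shifting each of them by one box amounts to moving
    -- the last one to the beginning of the run.
    have e3 : moveBox (moveBox f (i, c + m) (i, c)) (i, c + m + 1) (i, c + m) =
        moveBox f (i, c + (m + 1)) (i, c) := by
      have h3 : f i (c + (m + 1)) = v := by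
        rw [← h1 m (by omega)]; congr 1; omega
      funext i' c'
      unfold moveBox at e1 ⊢
      by_cases hi : i' = i
      · subst hi
        simp only [Prod.mk.injEq, true_and] at e1 ⊢
        rw [e1, h3, ← Nat.add_assoc]
        by_cases h4 : c' = c + m
        · rw [if_pos h4]
          rcases m with _ | m
          · rw [if_pos (by omega)]
          · rw [if_neg (by omega), if_neg (by omega), ← h1 m (by omega), h4]
            congr 1; omega
        · rw [if_neg h4]
          by_cases h5 : c' = c
          · rw [if_neg (by omega), if_pos h5, if_pos h5]
            rcases m with _ | m
            · omega
            · rw [← h1 m (by omega)]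
              congr 1; omega
          · rw [if_neg h5, if_neg h4, if_neg h5]
      · simp [hi]
    rw [← e3]
    refine JdtStep.fromRight _ i (c + m) (e1 ▸ hv) ?_
    rw [e1, e2]
    exact h2 m (by omega)

namespace SkewTableau

section Slide

variable (S : SkewTableau) {k : ℕ} (hk : S.rowCount (k + 1) 0 < S.rowCount k 0)

/-- The filling in the course of a slide, after the numbers `1, …, j` have been moved. -/
noncomputable def partialSlide (j i c : ℕ) : ℕ :=
  if c < S.slideCount k i j then (S.slideResult hk).entry i c
  else if c < S.rowCount i j then 0 else S.entry i c

theorem partialSlide_zero : S.partialSlide hk 0 = S.entry := by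
  funext i c
  unfold partialSlide
  have h1 := (S.slideResult hk).lt_rowCount i c 0
  have h2 := S.lt_rowCount i c 0
  rw [rowCount_slideResult] at h1
  split_ifs with h3 h4
  · have h4 : c < S.rowCount i 0 := h3.trans_le (Nat.sub_le _ _)
    have := h1.1 h3
    have := h2.1 h4
    omega
  · have := h2.1 h4
    omega
  · rfl

theorem partialSlide_bound : S.partialSlide hk S.bound = (S.slideResult hk).entry := by
  funext i c
  unfold partialSlide
  split_ifs with h3 h4
  · rfl
  all_goals
    have h5 : (i, c) ∉ (S.slideResult hk).outer := by
      intro h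
      have := ((S.slideResult hk).lt_rowCount i c
        ((S.slideResult hk).entry i c)).2 ⟨h, le_rfl⟩
      rw [rowCount_slideResult] at this
      exact h3 (this.trans_le (S.slideCount_le_bound hk i _))
    rw [SkewTableau.entry_outside _ _ _ h5]
  exact S.entry_outside i c (fun h => h4 ((S.mem_outer_iff le_rfl i c).1 h))

theorem partialSlide_eq_of_le {j i c : ℕ} (h : S.rowCount i j ≤ c) :
    S.partialSlide hk j i c = S.entry i c := by
  unfold partialSlide
  rw [if_neg, if_neg (not_lt.2 h)]
  exact not_lt.2 ((Nat.sub_le _ _).trans h)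

theorem partialSlide_hole {j i : ℕ} (h : S.hole k j = i) :
    S.partialSlide hk j i (S.rowCount i j - 1) = 0 := by
  have h1 := S.rowCount_hole_succ_lt hk j
  unfold partialSlide slideCount
  rw [if_pos h, if_neg (lt_irrefl _), if_pos]
  subst h
  omega

/-- The two stages read from different fillings only where `S.rowCount i j ≤ c < S.slideCount k i (j
+ 1)`, and there the old and the new entry are both `j + 1`. -/
theorem partialSlide_succ_eq {j i c : ℕ} (h1 : c < S.slideCount k i (j + 1) ∨ S.rowCount i (j + 1) ≤ c)
    (h2 : c < S.slideCount k i j ∨ S.rowCount i j ≤ c) :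
    S.partialSlide hk (j + 1) i c = S.partialSlide hk j i c := by
  rcases h1 with h1 | h1
  · rcases h2 with h2 | h2
    · unfold partialSlide
      rw [if_pos h1, if_pos h2]
    · have h3 : S.slideCount k i j ≤ c := (Nat.sub_le _ _).trans h2
      have h4 : c < S.rowCount i (j + 1) := h1.trans_le (Nat.sub_le _ _)
      rw [partialSlide_eq_of_le S hk h2, S.entry_eq_of_rowCount h2 h4]
      unfold partialSlide
      rw [if_pos h1]
      rw [← rowCount_slideResult S hk] at h1 h3
      exact entry_eq_of_rowCount _ h3 h1
  · rw [partialSlide_eq_of_le S hk h1,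
      partialSlide_eq_of_le S hk ((S.rowCount_mono i (Nat.le_add_right j 1)).trans h1)]

theorem jdt_partialSlide_succ (j : ℕ) :
    Relation.ReflTransGen JdtStep
      (S.partialSlide hk j, (S.hole k j, S.rowCount (S.hole k j) j - 1))
      (S.partialSlide hk (j + 1),
        (S.hole k (j + 1), S.rowCount (S.hole k (j + 1)) (j + 1) - 1)) := by
  have h3 := S.rowCount_hole_succ_lt hk j
  have h4 := S.rowCount_hole_succ_lt hk (j + 1)
  have h6 := S.rowCount_mono (S.hole k j) (Nat.le_add_right j 1)
  have h7 := S.rowCount_mono (S.hole k j + 1) (Nat.le_add_right j 1)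
  rcases S.hole_succ k j with ⟨h1, -, h2⟩ | ⟨h1, -, h2⟩
  · rw [h2, h1]
    rw [h2] at h4
    obtain ⟨i, hi⟩ : ∃ i, S.hole k j = i := ⟨_, rfl⟩
    obtain ⟨c, hc⟩ : ∃ c, S.rowCount i j = c + 1 := ⟨S.rowCount i j - 1, by rw [← hi]; omega⟩
    rw [hi] at h1 h2 h3 h4 h6 h7 ⊢
    have hs : S.rowCount i j - 1 = c := by omega
    rw [hs]
    have e1 : S.partialSlide hk j (i + 1) c = j + 1 := by
      rw [partialSlide_eq_of_le S hk (by omega), S.entry_eq_of_rowCount (j := j) (by omega) (by omega)]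
    have e2 : S.partialSlide hk j i (c + 1) = 0 ∨ j + 1 ≤ S.partialSlide hk j i (c + 1) := by
      rw [partialSlide_eq_of_le S hk (by omega)]
      exact S.entry_of_rowCount_le (by omega)
    -- The hole drops in one step: the number below is `j + 1`, and the one to the right is absent
    -- or at least `j + 1`, so the lower one wins even in case of a tie.
    refine Relation.ReflTransGen.single ?_
    convert JdtStep.fromBelow (S.partialSlide hk j) i c (by omega) (by omega) using 2
    funext i' c'
    unfold moveBox
    by_cases h8 : (i', c') = (i, c)
    · rw [if_pos h8]
      obtain ⟨rfl, rfl⟩ := Prod.mk.inj h8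
      rw [e1]
      have h9 : c' < S.slideCount k i' (j + 1) := by
        unfold slideCount
        rw [if_neg (by omega)]
        omega
      have h10 : S.slideCount k i' j ≤ c' := by
        unfold slideCount
        rw [if_pos hi]
        omega
      unfold partialSlide
      rw [if_pos h9]
      rw [← rowCount_slideResult S hk] at h9 h10
      exact entry_eq_of_rowCount _ h10 h9
    · rw [if_neg h8]
      by_cases h9 : (i', c') = (i + 1, c)
      · rw [if_pos h9]
        obtain ⟨rfl, rfl⟩ := Prod.mk.inj h9
        have := S.partialSlide_hole hk h2
        rwa [h1, hs] at this
      · rw [if_neg h9]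
        rw [Prod.mk.injEq] at h8 h9
        apply partialSlide_succ_eq
        · unfold slideCount
          by_cases h10 : S.hole k (j + 1) = i'
          · rw [if_pos h10]
            rw [h2] at h10
            subst h10
            omega
          · rw [if_neg h10]
            omega
        · unfold slideCount
          by_cases h10 : S.hole k j = i'
          · rw [if_pos h10]
            rw [hi] at h10
            subst h10
            omega
          · rw [if_neg h10]
            omega
  · rw [h2]
    obtain ⟨i, hi⟩ : ∃ i, S.hole k j = i := ⟨_, rfl⟩
    obtain ⟨c, hc⟩ : ∃ c, S.rowCount i j = c + 1 := ⟨S.rowCount i j - 1, by rw [← hi]; omega⟩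
    rw [h2] at h4
    rw [hi] at h1 h2 h3 h4 h6 h7 ⊢
    -- `m` is the number of `j + 1`'s in the row of the hole; for `m = 0` the hole does not move.
    obtain ⟨m, hm⟩ : ∃ m, S.rowCount i (j + 1) = c + 1 + m := ⟨S.rowCount i (j + 1) - (c + 1), by
      omega⟩
    have hs : S.rowCount i j - 1 = c := by omega
    have hs' : S.rowCount i (j + 1) - 1 = c + m := by omega
    have hx : ∀ t < m, S.partialSlide hk j i (c + 1 + t) = j + 1 := by
      intro t ht
      rw [partialSlide_eq_of_le S hk (by omega), S.entry_eq_of_rowCount (j := j) (by omega) (by omega)]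
    have hole0 := S.partialSlide_hole hk hi
    have hole1 := S.partialSlide_hole hk h2
    rw [hs] at hole0
    rw [hs'] at hole1
    rw [hs, hs']
    convert jdt_run_right (S.partialSlide hk j) i c (j + 1) (Nat.succ_ne_zero j) m hx ?_ using 2
    · funext i' c'
      unfold moveBox
      by_cases h8 : (i', c') = (i, c)
      · rw [if_pos h8]
        obtain ⟨rfl, rfl⟩ := Prod.mk.inj h8
        rcases m with _ | m
        · exact hole1.trans hole0.symm
        · have := hx m (by omega)
          rw [show c' + 1 + m = c' + (m + 1) by omega] at this
          rw [this]
          have h9 : c' < S.slideCount k i' (j + 1) := by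
            unfold slideCount
            rw [if_pos h2]
            omega
          have h10 : S.slideCount k i' j ≤ c' := by
            unfold slideCount
            rw [if_pos hi]
            omega
          unfold partialSlide
          rw [if_pos h9]
          rw [← rowCount_slideResult S hk] at h9 h10
          exact entry_eq_of_rowCount _ h10 h9
      · rw [if_neg h8]
        by_cases h9 : (i', c') = (i, c + m)
        · rw [if_pos h9]
          obtain ⟨rfl, rfl⟩ := Prod.mk.inj h9
          exact hole1
        · rw [if_neg h9]
          rw [Prod.mk.injEq] at h8 h9
          apply partialSlide_succ_eq
          · unfold slideCount
            by_cases h10 : S.hole k (j + 1) = i'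
            · rw [if_pos h10]
              rw [h2] at h10
              subst h10
              omega
            · rw [if_neg h10]
              omega
          · unfold slideCount
            by_cases h10 : S.hole k j = i'
            · rw [if_pos h10]
              rw [hi] at h10
              subst h10
              omega
            · rw [if_neg h10]
              omega
    -- As `W` does not vanish at the hole, the entries at most `j + 1` in the next row end before
    -- column `c`, so everything below the run is absent or larger than `j + 1`.
    · intro t ht
      rw [partialSlide_eq_of_le S hk (by omega)]
      exact S.entry_of_rowCount_le (by omega)

theorem slide_slideResult : Slide S k (S.hole k S.bound) (S.slideResult hk) := by
  have h3 := S.rowCount_hole_succ_lt hk S.bound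
  refine ⟨S.rowCount k 0 - 1, S.rowCount (S.hole k S.bound) S.bound - 1, S.isCorner_inner hk, ?_,
    ?_, ?_, rfl, rfl⟩
  · have key : ∀ j, Relation.ReflTransGen JdtStep (S.entry, (k, S.rowCount k 0 - 1))
        (S.partialSlide hk j, (S.hole k j, S.rowCount (S.hole k j) j - 1)) := by
      intro j
      induction j with
      | zero => rw [partialSlide_zero]; exact .refl
      | succ j ih => exact ih.trans (S.jdt_partialSlide_succ hk j)
    have := key S.bound
    rwa [partialSlide_bound] at this
  · rw [← partialSlide_bound, partialSlide_eq_of_le S hk (by omega)]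
    exact S.entry_outside _ _ (by rw [S.mem_outer_iff le_rfl]; omega)
  · rw [← partialSlide_bound, partialSlide_eq_of_le S hk (by omega)]
    exact S.entry_outside _ _ (by rw [S.mem_outer_iff le_rfl]; omega)

end Slide

end SkewTableau

/-! ### Uniqueness of slides -/

theorem jdtStep_unique {x y z : (ℕ → ℕ → ℕ) × (ℕ × ℕ)} (h1 : JdtStep x y) (h2 : JdtStep x z) :
    y = z := by
  cases h1 with
  | fromBelow f i c hb h =>
    cases h2 with
    | fromBelow => rfl
    | fromRight _ _ _ hr h' => omega
  | fromRight f i c hr h =>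
    cases h2 with
    | fromBelow _ _ _ hb h' => omega
    | fromRight => rfl

theorem not_jdtStep {f : ℕ → ℕ → ℕ} {i c : ℕ} (h1 : f (i + 1) c = 0) (h2 : f i (c + 1) = 0)
    (y : (ℕ → ℕ → ℕ) × (ℕ × ℕ)) : ¬ JdtStep (f, (i, c)) y := by
  intro h
  cases h with
  | fromBelow _ _ _ hb _ => exact hb h1
  | fromRight _ _ _ hr _ => exact hr h2

theorem jdt_final_unique {x y z : (ℕ → ℕ → ℕ) × (ℕ × ℕ)} (h1 : Relation.ReflTransGen JdtStep x y)
    (h2 : Relation.ReflTransGen JdtStep x z) (hy : ∀ u, ¬ JdtStep y u) (hz : ∀ u, ¬ JdtStep z u) :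
    y = z := by
  induction h1 using Relation.ReflTransGen.head_induction_on with
  | refl =>
    rcases h2.cases_head with h | ⟨u, hu, -⟩
    · exact h
    · exact absurd hu (hy u)
  | head hab _ ih =>
    rcases h2.cases_head with h | ⟨u, hu, hv⟩
    · subst h
      exact absurd hab (hz _)
    · exact ih (jdtStep_unique hab hu ▸ hv)

theorem Slide.unique {S S₁ S₂ : SkewTableau} {k r₁ r₂ : ℕ} (h1 : Slide S k r₁ S₁)
    (h2 : Slide S k r₂ S₂) : r₁ = r₂ ∧ S₁ = S₂ := by
  obtain ⟨c, d, hc, hp, e1, e2, hi, ho⟩ := h1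
  obtain ⟨c', d', hc', hp', e1', e2', hi', ho'⟩ := h2
  have : c = c' := by
    rw [SkewTableau.isCorner_inner_iff] at hc hc'
    omega
  subst this
  have h := jdt_final_unique hp hp' (not_jdtStep e1 e2) (not_jdtStep e1' e2')
  simp only [Prod.mk.injEq] at h
  obtain ⟨h3, h4, h5⟩ := h
  subst h4 h5
  exact ⟨rfl, SkewTableau.ext (YoungDiagram.ext (ho.trans ho'.symm))
    (YoungDiagram.ext (hi.trans hi'.symm)) h3⟩

theorem exists_slide {S : SkewTableau} {k c : ℕ} (h : IsCorner S.inner (k, c)) :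
    ∃ r S₁, Slide S k r S₁ := by
  rw [SkewTableau.isCorner_inner_iff] at h
  exact ⟨_, _, S.slide_slideResult (k := k) (by omega)⟩

theorem Slide.wMatrix_eq {S S₁ : SkewTableau} {k r : ℕ} (h : Slide S k r S₁) :
    S₁.wMatrix = slideW k S.wMatrix ∧ ∀ j, S.bound ≤ j → holeRow k S.wMatrix j = r := by
  obtain ⟨c, -, hc, -⟩ := id h
  rw [SkewTableau.isCorner_inner_iff] at hc
  have hk : S.rowCount (k + 1) 0 < S.rowCount k 0 := by omega
  obtain ⟨rfl, rfl⟩ := h.unique (S.slide_slideResult hk)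
  exact ⟨S.wMatrix_slideResult hk, fun j hj => S.hole_eq_of_bound_le hk hj⟩

theorem existsUnique_slides (S : SkewTableau) (Q : List ℕ) (hQ : IsStartSequence S.inner Q) :
    ∃! R : List ℕ × SkewTableau, Slides S Q R.1 R.2 := by
  induction Q generalizing S with
  | nil =>
    refine ⟨([], S), .nil S, ?_⟩
    rintro ⟨R, T⟩ h
    cases h
    rfl
  | cons k Q ih =>
    cases hQ with
    | @cons _ ν _ c _ hc hν hQ =>
      obtain ⟨r, S₁, h⟩ := exists_slide hc
      have hin : S₁.inner = ν := by
        obtain ⟨c', d, hc', -, -, -, hi, -⟩ := h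
        rw [SkewTableau.isCorner_inner_iff] at hc hc'
        obtain rfl : c = c' := by omega
        exact YoungDiagram.ext (hi.trans hν.symm)
      obtain ⟨⟨R, T⟩, hR, hu⟩ := ih S₁ (hin ▸ hQ)
      refine ⟨(r :: R, T), .cons h hR, ?_⟩
      rintro ⟨R', T'⟩ h'
      cases h' with
      | cons h1 h2 =>
        obtain ⟨rfl, rfl⟩ := h.unique h1
        have := hu (_, T') h2
        rw [Prod.mk.injEq] at this ⊢
        exact ⟨by rw [this.1], this.2⟩

/-! ### Words of kickers and row insertion -/

/-- The balls after a single kicker, starting at site `a`, has acted. -/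
def letterBalls (a : ℕ) (w : ℕ → ℕ) : ℕ → ℕ := balls (Pi.single a 1) w

theorem letterBalls_apply (a : ℕ) (w : ℕ → ℕ) (i : ℕ) : letterBalls a w i =
    if w a = 0 then w i else (if i = a then w i - 1 else w i) + if i + 1 = a then 1 else 0 :=
  balls_single a w i

theorem letterBalls_of_eq_zero {a : ℕ} {w : ℕ → ℕ} (h : w a = 0) : letterBalls a w = w := by
  funext i
  rw [letterBalls_apply, if_pos h]

/-- The balls after the kickers at the sites of a word have acted one after the other. -/
def wordBalls : List ℕ → (ℕ → ℕ) → ℕ → ℕ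
  | [], w => w
  | a :: Q, w => wordBalls Q (letterBalls a w)

/-- The sites of the kickers of a word after they have acted one after the other. -/
def wordKickers : List ℕ → (ℕ → ℕ) → List ℕ
  | [], _ => []
  | a :: Q, w => letterStep w a :: wordKickers Q (letterBalls a w)

theorem wordBalls_append (Q R : List ℕ) (w : ℕ → ℕ) :
    wordBalls (Q ++ R) w = wordBalls R (wordBalls Q w) := by
  induction Q generalizing w with
  | nil => rfl
  | cons a Q ih => exact ih _

theorem wordKickers_append (Q R : List ℕ) (w : ℕ → ℕ) :
    wordKickers (Q ++ R) w = wordKickers Q w ++ wordKickers R (wordBalls Q w) := by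
  induction Q generalizing w with
  | nil => rfl
  | cons a Q ih => exact congrArg _ (ih _)

theorem le_letterStep (w : ℕ → ℕ) (a : ℕ) : a ≤ letterStep w a := by
  unfold letterStep
  split_ifs <;> omega

/-- A kicker that moves on has changed no balls, so a second one at the same site moves on too, and
one further right is already at `a + 1` or beyond. -/
theorem letterStep_le_letterStep {a b : ℕ} (h : a ≤ b) (w : ℕ → ℕ) :
    letterStep w a ≤ letterStep (letterBalls a w) b := by
  unfold letterStep
  by_cases h1 : w a = 0
  · rw [letterBalls_of_eq_zero h1, if_pos h1]
    rcases h.lt_or_eq with h2 | rfl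
    · split_ifs <;> omega
    · rw [if_pos h1]
  · rw [if_neg h1]
    split_ifs <;> omega

theorem pairwise_wordKickers {R : List ℕ} (h : R.Pairwise (· ≤ ·)) (w : ℕ → ℕ) :
    (wordKickers R w).Pairwise (· ≤ ·) := by
  induction R generalizing w with
  | nil => exact List.Pairwise.nil
  | cons a R ih =>
    have ih' := ih h.tail (letterBalls a w)
    refine List.Pairwise.cons ?_ ih'
    cases R with
    | nil => intro z hz; cases hz
    | cons b R =>
      intro z hz
      have h1 := letterStep_le_letterStep ((List.pairwise_cons.1 h).1 b List.mem_cons_self) w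
      rcases List.mem_cons.1 hz with rfl | hz
      · exact h1
      · exact h1.trans ((List.pairwise_cons.1 ih').1 z hz)

/-- Kickers at the sites `q < z` commute, unless the one at `z = q + 1` kicks the only ball that
the one at `q` can use. -/
theorem letter_comm {q z : ℕ} (h : q < z) {w : ℕ → ℕ} (hC : z = q + 1 → w (q + 1) = 0 ∨ w q ≠ 0) :
    letterStep (letterBalls z w) q = letterStep w q ∧
    letterStep (letterBalls q w) z = letterStep w z ∧
    letterBalls q (letterBalls z w) = letterBalls z (letterBalls q w) := by
  have hq : letterBalls z w q = 0 ↔ w q = 0 := by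
    rw [letterBalls_apply]
    by_cases h1 : w z = 0
    · rw [if_pos h1]
    · rw [if_neg h1, if_neg (by omega)]
      by_cases h2 : q + 1 = z
      · rw [if_pos h2]
        subst h2
        have := hC rfl
        omega
      · rw [if_neg h2, Nat.add_zero]
  have hz : letterBalls q w z = w z := by
    rw [letterBalls_apply]
    split_ifs <;> omega
  refine ⟨by unfold letterStep; simp only [hq], by unfold letterStep; rw [hz], ?_⟩
  funext i
  rw [letterBalls_apply q (letterBalls z w), letterBalls_apply z (letterBalls q w), hz]
  simp only [hq]
  rw [letterBalls_apply, letterBalls_apply]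
  by_cases h1 : w z = 0
  · simp [h1]
  · by_cases h2 : w q = 0
    · simp [h2]
    · simp only [h1, h2, if_false]
      by_cases h3 : i = q
      · subst h3
        simp only [if_true]
        split_ifs <;> omega
      · simp only [h3, if_false]
        split_ifs <;> omega

/-- `letter_comm` is iterated along the word; its proviso has to be assumed only once, for the
initial state of the balls. -/
theorem word_letter_comm {q : ℕ} {R : List ℕ} (hR : R.Pairwise (· ≤ ·)) (h : ∀ z ∈ R, q < z)
    {w : ℕ → ℕ} (hC : q + 1 ∈ R → w (q + 1) = 0 ∨ w q ≠ 0) :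
    letterStep (wordBalls R w) q = letterStep w q ∧
    wordKickers R (letterBalls q w) = wordKickers R w ∧
    letterBalls q (wordBalls R w) = wordBalls R (letterBalls q w) := by
  induction R generalizing w with
  | nil => exact ⟨rfl, rfl, rfl⟩
  | cons z R ih =>
    have hz := h z List.mem_cons_self
    obtain ⟨a1, a2, a3⟩ := letter_comm hz (w := w)
      (fun e => hC (e ▸ List.mem_cons_self))
    obtain ⟨b1, b2, b3⟩ := ih hR.tail (fun x hx => h x (List.mem_cons_of_mem _ hx))
      (w := letterBalls z w) (by
        -- By sortedness `q + 1` is then also the head. After the head has acted, either site `q +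
        -- 1` was empty and still is, or a ball has landed at `q`, so the proviso persists.
        intro hm
        have h1 := (List.pairwise_cons.1 hR).1 _ hm
        obtain rfl : z = q + 1 := by omega
        have h2 := hC List.mem_cons_self
        rw [letterBalls_apply, letterBalls_apply]
        by_cases h3 : w (q + 1) = 0
        · rw [if_pos h3]
          exact Or.inl h3
        · right
          simp [h3])
    refine ⟨b1.trans a1, ?_, ?_⟩
    · simp only [wordKickers]
      rw [a2, ← b2, a3]
    · simp only [wordBalls]
      rw [b3, a3]

/-! ### Insertion into a row and the action on balls -/

theorem rowBump_of_forall_le {t : ℕ} {R : List ℕ} (h : ∀ a ∈ R, a ≤ t) :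
    rowBump t R = (R ++ [t], none) := by
  induction R with
  | nil => rfl
  | cons a R ih =>
    rw [rowBump, if_neg (not_lt.2 (h a List.mem_cons_self)),
      ih fun b hb => h b (List.mem_cons_of_mem _ hb)]
    rfl

theorem forall_le_of_rowBump_none {t : ℕ} {R : List ℕ} (h : (rowBump t R).2 = none) :
    ∀ a ∈ R, a ≤ t := by
  induction R with
  | nil => intro a ha; cases ha
  | cons b R ih =>
    rw [rowBump] at h
    split_ifs at h with h1
    intro a ha
    rcases List.mem_cons.1 ha with rfl | ha
    · exact not_lt.1 h1
    · exact ih h a ha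

theorem mem_rowBump {t x : ℕ} {R : List ℕ} (h : x ∈ (rowBump t R).1) : x = t ∨ x ∈ R := by
  induction R with
  | nil => exact Or.inl (List.mem_singleton.1 h)
  | cons a R ih =>
    rw [rowBump] at h
    split_ifs at h with h1
    · rcases List.mem_cons.1 h with h | h
      · exact Or.inl h
      · exact Or.inr (List.mem_cons_of_mem _ h)
    · rcases List.mem_cons.1 h with h | h
      · exact Or.inr (h ▸ List.mem_cons_self)
      · exact (ih h).imp_right (List.mem_cons_of_mem _)

theorem pairwise_rowBump {R : List ℕ} (hR : R.Pairwise (· ≤ ·)) (t : ℕ) :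
    (rowBump t R).1.Pairwise (· ≤ ·) := by
  induction R with
  | nil => exact List.pairwise_singleton _ _
  | cons a R ih =>
    have h2 := (List.pairwise_cons.1 hR).1
    rw [rowBump]
    split_ifs with h1
    · exact List.Pairwise.cons (fun b hb => (h1.trans_le (h2 b hb)).le) hR.tail
    · refine List.Pairwise.cons (fun b hb => ?_) (ih hR.tail)
      rcases mem_rowBump hb with rfl | hb
      · exact not_lt.1 h1
      · exact h2 b hb

theorem lt_of_rowBump_some {t b : ℕ} {R : List ℕ} (h : (rowBump t R).2 = some b) : t < b := by
  induction R with
  | nil => cases h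
  | cons a R ih =>
    rw [rowBump] at h
    split_ifs at h with h1
    · exact Option.some.inj h ▸ h1
    · exact ih h

/-- The first entry of a row after an insertion is at most the inserted number. -/
theorem rowBump_head_le (t : ℕ) (R : List ℕ) : ∃ y L, (rowBump t R).1 = y :: L ∧ y ≤ t := by
  cases R with
  | nil => exact ⟨t, [], rfl, le_rfl⟩
  | cons a R =>
    rw [rowBump]
    split_ifs with h1
    · exact ⟨t, R, rfl, le_rfl⟩
    · exact ⟨a, _, rfl, not_lt.1 h1⟩

/-- Row insertion commutes with the action on balls, if the letter fits at the end of the row. -/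
theorem rowBump_wordKickers_none {R : List ℕ} (hR : R.Pairwise (· ≤ ·)) {q : ℕ} (w : ℕ → ℕ)
    (h : (rowBump q R).2 = none) :
    rowBump (letterStep (wordBalls R w) q) (wordKickers R w) =
      (wordKickers (rowBump q R).1 w, none) ∧
    wordBalls (rowBump q R).1 w = letterBalls q (wordBalls R w) := by
  have h1 := forall_le_of_rowBump_none h
  rw [rowBump_of_forall_le h1, wordBalls_append, wordKickers_append]
  refine ⟨rowBump_of_forall_le ?_, rfl⟩
  have h2 := pairwise_wordKickers (R := R ++ [q])
    (List.pairwise_append.2 ⟨hR, List.pairwise_singleton _ _, fun a ha b hb =>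
      List.mem_singleton.1 hb ▸ h1 a ha⟩) w
  rw [wordKickers_append] at h2
  intro a ha
  exact (List.pairwise_append.1 h2).2.2 a ha _ List.mem_cons_self

/-- Row insertion commutes with the action on balls, if the letter bumps a letter `b`, which then
acts before the row. -/
theorem rowBump_wordKickers_some {R : List ℕ} (hR : R.Pairwise (· ≤ ·)) {q b : ℕ} (w : ℕ → ℕ)
    (h : (rowBump q R).2 = some b) :
    rowBump (letterStep (wordBalls R w) q) (wordKickers R w) =
      (wordKickers (rowBump q R).1 (letterBalls b w), some (letterStep w b)) ∧
    wordBalls (rowBump q R).1 (letterBalls b w) = letterBalls q (wordBalls R w) := by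
  induction R generalizing w with
  | nil => cases h
  | cons a R ih =>
    have ha := (List.pairwise_cons.1 hR).1
    rw [rowBump] at h ⊢
    by_cases h1 : q < a
    · rw [if_pos h1] at h ⊢
      obtain rfl : a = b := Option.some.inj h
      obtain ⟨c1, c2, c3⟩ := word_letter_comm (R := R) hR.tail (fun z hz => h1.trans_le (ha z hz))
        (w := letterBalls a w) (by
          intro hm
          have := ha _ hm
          obtain rfl : a = q + 1 := by omega
          rw [letterBalls_apply, letterBalls_apply]
          by_cases h3 : w (q + 1) = 0
          · rw [if_pos h3]
            exact Or.inl h3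
          · right
            simp [h3])
      simp only [wordKickers, wordBalls]
      rw [c1, c2, c3]
      refine ⟨?_, rfl⟩
      rw [rowBump, if_pos]
      -- A kicker that stays at `q + 1` has kicked a ball to `q`, so the kicker at `q` stays as well
      -- and cannot catch up with `a`.
      have h4 : letterStep (letterBalls a w) q = q ∨ a ≠ q + 1 ∨ letterStep w a ≠ a := by
        by_contra! h5
        obtain ⟨h5, rfl, h6⟩ := h5
        have h7 : w (q + 1) ≠ 0 := by
          intro h8
          rw [letterStep, if_pos h8] at h6
          omega
        have h8 : letterBalls (q + 1) w q ≠ 0 := by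
          rw [letterBalls_apply]
          simp [h7]
        rw [letterStep, if_neg h8] at h5
        exact h5 rfl
      have h5 := le_letterStep w a
      have h6 : letterStep (letterBalls a w) q ≤ q + 1 := by
        unfold letterStep
        split_ifs <;> omega
      omega
    · rw [if_neg h1] at h ⊢
      have h2 := lt_of_rowBump_some h
      obtain ⟨ih1, ih2⟩ := ih hR.tail (letterBalls a w) h
      obtain ⟨y, L, hy, hyq⟩ := rowBump_head_le q R
      have hsort : (a :: (rowBump q R).1).Pairwise (· ≤ ·) := by
        have := pairwise_rowBump hR q
        rwa [rowBump, if_neg h1] at this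
      have hay : a ≤ y := (List.pairwise_cons.1 hsort).1 y (hy ▸ List.mem_cons_self)
      obtain ⟨y', L', hy', hyq'⟩ := rowBump_head_le
        (letterStep (wordBalls R (letterBalls a w)) q) (wordKickers R (letterBalls a w))
      simp only [wordKickers, wordBalls]
      -- The exception to `letter_comm`: `b` kicks to site `a` the only ball that a kicker there can
      -- use. The new row then begins with two letters `a`: one stays thanks to this ball, the other
      -- moves to `a + 1`. On the insertion side the leading letter has become `a + 1` and is the
      -- one bumped, in place of an equal letter behind it.
      by_cases hE : b = a + 1 ∧ w (a + 1) ≠ 0 ∧ w a = 0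
      · obtain ⟨rfl, hb, hw⟩ := hE
        obtain rfl : y = a := by omega
        have e1 : letterBalls y w = w := letterBalls_of_eq_zero hw
        have e2 : letterStep w y = y + 1 := by rw [letterStep, if_pos hw]
        have e3 : letterStep w (y + 1) = y + 1 := by rw [letterStep, if_neg hb]
        have e4 : letterBalls (y + 1) w y = 1 := by
          rw [letterBalls_apply, if_neg hb]
          simp [hw]
        have e5 : letterStep (letterBalls (y + 1) w) y = y := by
          rw [letterStep, e4, if_neg one_ne_zero]
        have e6 : letterBalls y (letterBalls (y + 1) w) y = 0 := by
          rw [letterBalls_apply, e4]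
          simp
        rw [e1, hy] at ih1 ih2
        rw [e1, e2, e3, hy]
        simp only [wordKickers, wordBalls] at ih1 ih2 ⊢
        rw [e3, e5] at ih1
        have e7 : letterStep (letterBalls y (letterBalls (y + 1) w)) y = y + 1 := by
          rw [letterStep, if_pos e6]
        rw [letterBalls_of_eq_zero e6, e5, e7]
        refine ⟨?_, ih2⟩
        have hs := (List.pairwise_cons.1 (pairwise_wordKickers hR w)).1
        rw [e2, e1] at hs
        generalize letterStep (wordBalls R w) q = q' at ih1 ⊢
        generalize wordKickers R w = R' at ih1 hs ⊢
        cases R' with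
        | nil => simp [rowBump] at ih1
        | cons h R' =>
          have h3 := hs h List.mem_cons_self
          rw [rowBump] at ih1
          -- Since `h ≥ y + 1`, the head must be the letter that is bumped; otherwise it would
          -- remain in front, where the induction hypothesis has `y`.
          by_cases h4 : q' < h
          · rw [if_pos h4] at ih1
            simp only [Prod.mk.injEq, List.cons.injEq, Option.some.injEq] at ih1
            obtain ⟨⟨rfl, h5⟩, rfl⟩ := ih1
            rw [rowBump, if_pos (Nat.lt_succ_self _), h5]
          · rw [if_neg h4] at ih1
            simp only [Prod.mk.injEq, List.cons.injEq] at ih1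
            omega
      · obtain ⟨c1, c2, c3⟩ := letter_comm (q := a) (z := b) (w := w) (by omega) (by
          intro e
          subst e
          by_contra! h3
          exact hE ⟨rfl, h3⟩)
        rw [ih1] at hy'
        rw [c3, c1, ← c2]
        refine ⟨?_, ih2⟩
        -- The image of `a` is not bumped: it is at most the head of the remaining row after
        -- insertion, which in turn is at most the inserted letter.
        rw [rowBump, if_neg]
        · rw [ih1]
        rw [not_lt]
        refine le_trans ?_ hyq'
        have hs := (List.pairwise_cons.1 (pairwise_wordKickers hsort (letterBalls b w))).1
        rw [c1, c3] at hs
        exact hs _ (by rw [show wordKickers _ _ = _ from hy']; exact List.mem_cons_self)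

/-! ### Tableaux of kickers -/

/-- The balls after the rows of a tableau have acted, from the last one to the first one. -/
def tabBalls : List (List ℕ) → (ℕ → ℕ) → ℕ → ℕ
  | [], w => w
  | R :: T, w => wordBalls R (tabBalls T w)

/-- The tableau of the kickers after its rows have acted, from the last one to the first one. -/
def tabKickers : List (List ℕ) → (ℕ → ℕ) → List (List ℕ)
  | [], _ => []
  | R :: T, w => wordKickers R (tabBalls T w) :: tabKickers T w

theorem length_tabKickers (T : List (List ℕ)) (w : ℕ → ℕ) :
    (tabKickers T w).length = T.length := by
  induction T with
  | nil => rfl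
  | cons R T ih => exact congrArg (· + 1) ih

theorem pairwise_rowInsert {T : List (List ℕ)} (hT : ∀ R ∈ T, R.Pairwise (· ≤ ·)) (q : ℕ) :
    ∀ R ∈ rowInsert T q, R.Pairwise (· ≤ ·) := by
  induction T generalizing q with
  | nil =>
    intro R hR
    rw [List.mem_singleton.1 hR]
    exact List.pairwise_singleton _ _
  | cons R T ih =>
    have h1 := pairwise_rowBump (hT R List.mem_cons_self) q
    have h2 : ∀ R ∈ T, R.Pairwise (· ≤ ·) := fun R hR => hT R (List.mem_cons_of_mem _ hR)
    rw [rowInsert]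
    rcases h : rowBump q R with ⟨R', _ | b⟩
    · rw [h] at h1
      exact List.forall_mem_cons.2 ⟨h1, h2⟩
    · rw [h] at h1
      exact List.forall_mem_cons.2 ⟨h1, ih h2 b⟩

theorem pairwise_pTableau (Q : List ℕ) : ∀ R ∈ pTableau Q, R.Pairwise (· ≤ ·) := by
  induction Q using List.reverseRecOn with
  | nil => intro R hR; cases hR
  | append_singleton Q q ih =>
    rw [pTableau, List.foldl_append]
    exact pairwise_rowInsert ih q

/-- Rows act from the last to the first, so a letter bumped out of `R` into the lower rows acts, by
induction, immediately before the modified `R`. This is the order in which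
`rowBump_wordKickers_some` needs it. -/
theorem rowInsert_tabKickers {T : List (List ℕ)} (hT : ∀ R ∈ T, R.Pairwise (· ≤ ·)) (q : ℕ)
    (w : ℕ → ℕ) :
    tabKickers (rowInsert T q) w = rowInsert (tabKickers T w) (letterStep (tabBalls T w) q) ∧
    tabBalls (rowInsert T q) w = letterBalls q (tabBalls T w) := by
  induction T generalizing q with
  | nil => exact ⟨rfl, rfl⟩
  | cons R T ih =>
    have h1 := hT R List.mem_cons_self
    have h2 : ∀ R ∈ T, R.Pairwise (· ≤ ·) := fun R hR => hT R (List.mem_cons_of_mem _ hR)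
    rw [rowInsert]
    rcases h : rowBump q R with ⟨R', _ | b⟩
    · obtain ⟨a1, a2⟩ := rowBump_wordKickers_none h1 (q := q) (tabBalls T w) (by rw [h])
      rw [h] at a1 a2
      simp only [tabKickers, tabBalls, rowInsert]
      rw [a1]
      exact ⟨rfl, a2⟩
    · obtain ⟨a1, a2⟩ := rowBump_wordKickers_some h1 (q := q) (b := b) (tabBalls T w) (by rw [h])
      obtain ⟨i1, i2⟩ := ih h2 b
      rw [h] at a1 a2
      simp only [tabKickers, tabBalls, rowInsert]
      rw [a1, i1, i2]
      exact ⟨rfl, a2⟩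

/-- Row insertion intertwines the action of words and the action of tableaux. -/
theorem tabKickers_pTableau (Q : List ℕ) (w : ℕ → ℕ) :
    tabKickers (pTableau Q) w = pTableau (wordKickers Q w) ∧
    tabBalls (pTableau Q) w = wordBalls Q w := by
  induction Q using List.reverseRecOn with
  | nil => exact ⟨rfl, rfl⟩
  | append_singleton Q q ih =>
    have h := rowInsert_tabKickers (pairwise_pTableau Q) q w
    rw [wordKickers_append, wordBalls_append]
    simp only [pTableau, List.foldl_append] at ih h ⊢
    change tabKickers (rowInsert _ q) w = rowInsert _ _ ∧ tabBalls (rowInsert _ q) w = _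
    rw [h.1, h.2, ih.1, ih.2]
    exact ⟨rfl, rfl⟩

/-- The leftmost kicker can be made to act first: a ball that it kicks lands to the left of all
other kickers, or leaves the system, and so is out of their reach. This is the inductive step for
`kickers_count`. -/
theorem kickers_add_single {P : ℕ → ℕ} {a : ℕ} (hP : ∀ i < a, P i = 0) (w : ℕ → ℕ) :
    kickers (fun i => P i + if a = i then 1 else 0) w =
      (fun i => kickers P (letterBalls a w) i + if letterStep w a = i then 1 else 0) ∧
    balls (fun i => P i + if a = i then 1 else 0) w = balls P (letterBalls a w) := by
  constructor
  · funext i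
    rcases i with _ | i
    · simp only [kickers, letterStep, letterBalls_apply]
      by_cases h1 : a = 0
      · subst h1
        split_ifs <;> first | omega | simp_all
      · have h2 := hP 0 (Nat.pos_of_ne_zero h1)
        split_ifs <;> simp_all
    · simp only [kickers, letterStep, letterBalls_apply]
      have h2 := hP i
      have h3 := hP (i + 1)
      by_cases h1 : a = i + 1
      · subst h1
        split_ifs <;> omega
      · by_cases h4 : a = i
        · subst h4
          split_ifs <;> omega
        · split_ifs <;> omega
  · funext i
    simp only [balls, letterBalls_apply]
    have h2 := hP i
    have h3 := hP (i + 1)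
    by_cases h1 : a = i + 1
    · subst h1
      split_ifs <;> omega
    · by_cases h4 : a = i
      · subst h4
        split_ifs <;> omega
      · split_ifs <;> omega

/-- The kicker-and-ball step for a vector is the action of the corresponding row. -/
theorem kickers_count {R : List ℕ} (hR : R.Pairwise (· ≤ ·)) (w : ℕ → ℕ) :
    kickers (fun i => R.count i) w = (fun i => (wordKickers R w).count i) ∧
    balls (fun i => R.count i) w = wordBalls R w := by
  induction R generalizing w with
  | nil =>
    constructor
    · funext i
      cases i <;> simp [kickers, wordKickers]
    · funext i
      simp [balls, wordBalls]
  | cons a R ih =>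
    obtain ⟨i1, i2⟩ := ih hR.tail (letterBalls a w)
    obtain ⟨k1, k2⟩ := kickers_add_single (P := fun i => R.count i) (a := a) (fun i hi => by
      refine List.count_eq_zero.2 fun hm => ?_
      have := (List.pairwise_cons.1 hR).1 i hm
      omega) w
    simp only [List.count_cons, beq_iff_eq, wordKickers, wordBalls]
    rw [k1, k2, i1, i2]
    exact ⟨rfl, rfl⟩

theorem tabBalls_append_singleton (T : List (List ℕ)) (R : List ℕ) (w : ℕ → ℕ) :
    tabBalls (T ++ [R]) w = tabBalls T (wordBalls R w) := by
  induction T with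
  | nil => rfl
  | cons R' T ih => exact congrArg _ ih

theorem tabKickers_append_singleton (T : List (List ℕ)) (R : List ℕ) (w : ℕ → ℕ) :
    tabKickers (T ++ [R]) w = tabKickers T (wordBalls R w) ++ [wordKickers R w] := by
  induction T with
  | nil => rfl
  | cons R' T ih =>
    simp only [List.cons_append, tabKickers]
    rw [ih, tabBalls_append_singleton]

/-- Agreement of `P` with `mult T` is required only on the rows of `T`, because the induction strips
the last row, which acts first, from `T` but not from `P`. -/
theorem colKickers_eq {T : List (List ℕ)} (hT : ∀ R ∈ T, R.Pairwise (· ≤ ·)) {P : ℕ → ℕ → ℕ}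
    (hP : ∀ p < T.length, P p = mult T p) (w : ℕ → ℕ) :
    colBalls P T.length w = tabBalls T w ∧
    ∀ p, colKickers P T.length w p =
      if p < T.length then mult (tabKickers T w) p else P p := by
  induction T using List.reverseRecOn generalizing w with
  | nil => exact ⟨rfl, fun p => rfl⟩
  | append_singleton T R ih =>
    have hl : (T ++ [R]).length = T.length + 1 := List.length_append
    have hl' := length_tabKickers T (wordBalls R w)
    have hk : P T.length = fun i => R.count i := by
      rw [hP _ (by omega)]
      funext i
      simp [mult]
    obtain ⟨k1, k2⟩ := kickers_count (hT R (by simp)) w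
    obtain ⟨i1, i2⟩ := ih (fun R hR => hT R (List.mem_append_left _ hR)) (fun p hp => by
      rw [hP p (by omega)]
      funext i
      simp only [mult]
      rw [List.getD_append _ _ _ _ hp]) (wordBalls R w)
    rw [hl]
    simp only [colBalls, colKickers]
    rw [hk, k1, k2, tabBalls_append_singleton, tabKickers_append_singleton]
    refine ⟨i1, fun p => ?_⟩
    rcases lt_trichotomy p T.length with h | h | h
    · rw [Function.update_of_ne h.ne, i2, if_pos h, if_pos (by omega)]
      funext i
      simp only [mult]
      rw [List.getD_append _ _ _ _ (by omega)]
    · subst h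
      rw [Function.update_self, if_pos (by omega)]
      funext i
      simp only [mult]
      rw [List.getD_append_right _ _ _ _ hl'.le, hl']
      simp
    · rw [Function.update_of_ne h.ne', i2, if_neg (by omega), if_neg (by omega)]

theorem colKickers_mult {T : List (List ℕ)} (hT : ∀ R ∈ T, R.Pairwise (· ≤ ·)) (w : ℕ → ℕ) :
    colKickers (mult T) T.length w = mult (tabKickers T w) ∧
    colBalls (mult T) T.length w = tabBalls T w := by
  obtain ⟨h1, h2⟩ := colKickers_eq hT (fun _ _ => rfl) w
  refine ⟨?_, h1⟩
  funext p i
  rw [h2]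
  split_ifs with h
  · rfl
  · simp only [mult]
    rw [List.getD_eq_default _ _ (not_lt.1 h),
      List.getD_eq_default _ _ (by rw [length_tabKickers]; omega)]

/-! ### Sequences of slides -/

/-- The rows of the holes of a sequence of slides, after the numbers `1, …, j` have been moved. -/
def holeRows : List ℕ → (ℕ → ℕ → ℕ) → ℕ → List ℕ
  | [], _, _ => []
  | k :: Q, W, j => holeRow k W j :: holeRows Q (slideW k W) j

theorem holeRows_zero (Q : List ℕ) (W : ℕ → ℕ → ℕ) : holeRows Q W 0 = Q := by
  induction Q generalizing W with
  | nil => rfl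
  | cons k Q ih => exact congrArg _ (ih _)

theorem slideW_column (k : ℕ) (W : ℕ → ℕ → ℕ) (j : ℕ) :
    (fun i => slideW k W i j) = letterBalls (holeRow k W j) (fun i => W i j) := by
  funext i
  rw [slideW, slideQ_eq, letterBalls]

/-- The diagram, defined slide by slide, is read here by columns: column `j` of `W` is met by one
kicker per slide, in the order of the slides. -/
theorem holeRows_succ (Q : List ℕ) (W : ℕ → ℕ → ℕ) (j : ℕ) :
    holeRows Q W (j + 1) = wordKickers (holeRows Q W j) (fun i => W i j) ∧
    (fun i => rectW Q W i j) = wordBalls (holeRows Q W j) (fun i => W i j) := by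
  induction Q generalizing W with
  | nil => exact ⟨rfl, rfl⟩
  | cons k Q ih =>
    obtain ⟨h1, h2⟩ := ih (slideW k W)
    simp only [holeRows, rectW, wordKickers, wordBalls]
    rw [h1, h2, slideW_column]
    exact ⟨rfl, rfl⟩

theorem rectQ_eq (Q : List ℕ) (W : ℕ → ℕ → ℕ) (j : ℕ) :
    rectQ Q W j = (holeRows Q W j).map fun r => Pi.single r 1 := by
  induction Q generalizing W with
  | nil => rfl
  | cons k Q ih =>
    simp only [rectQ, holeRows, List.map_cons]
    rw [ih, slideQ_eq]

theorem Slides.holeRows_eventually {S S' : SkewTableau} {Q Q' : List ℕ} (h : Slides S Q Q' S') :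
    rectW Q S.wMatrix = S'.wMatrix ∧ ∀ᶠ j in Filter.atTop, holeRows Q S.wMatrix j = Q' := by
  induction h with
  | nil S => exact ⟨rfl, Filter.Eventually.of_forall fun _ => rfl⟩
  | @cons S S₁ S' k r Q Q' h hs ih =>
    obtain ⟨h1, h2⟩ := h.wMatrix_eq
    rw [h1] at ih
    refine ⟨ih.1, ?_⟩
    filter_upwards [ih.2, Filter.eventually_ge_atTop S.bound] with j hj hb
    rw [holeRows, hj, h2 j hb]

theorem tabKickers_pTableau_holeRows (Q : List ℕ) (W : ℕ → ℕ → ℕ) (j : ℕ) :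
    tabKickers (pTableau (holeRows Q W j)) (fun i => W i j) = pTableau (holeRows Q W (j + 1)) := by
  rw [(tabKickers_pTableau _ _).1, (holeRows_succ Q W j).1]

/-- The number of rows never changes, so one fixed `k` serves for all columns in `arrayP` and
`arrayW`. -/
theorem length_pTableau_holeRows (Q : List ℕ) (W : ℕ → ℕ → ℕ) (j : ℕ) :
    (pTableau (holeRows Q W j)).length = (pTableau Q).length := by
  induction j with
  | zero => rw [holeRows_zero]
  | succ j ih => rw [← tabKickers_pTableau_holeRows, length_tabKickers, ih]

theorem arrayP_pTableau (Q : List ℕ) (W : ℕ → ℕ → ℕ) (j : ℕ) :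
    arrayP (pTableau Q).length (mult (pTableau Q)) W j = mult (pTableau (holeRows Q W j)) := by
  induction j with
  | zero => rw [holeRows_zero]; rfl
  | succ j ih =>
    rw [arrayP, ih, ← length_pTableau_holeRows Q W j, (colKickers_mult (pairwise_pTableau _) _).1,
      tabKickers_pTableau_holeRows]

theorem arrayW_pTableau (Q : List ℕ) (W : ℕ → ℕ → ℕ) :
    arrayW (pTableau Q).length (mult (pTableau Q)) W = rectW Q W := by
  funext i j
  rw [arrayW, arrayP_pTableau, ← length_pTableau_holeRows Q W j,
    (colKickers_mult (pairwise_pTableau _) _).2, (tabKickers_pTableau _ _).2,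
    ← (holeRows_succ Q W j).2]

theorem pTableau_holeRows_congr {Q₁ Q₂ : List ℕ} (h : pTableau Q₁ = pTableau Q₂)
    (W : ℕ → ℕ → ℕ) (j : ℕ) : pTableau (holeRows Q₁ W j) = pTableau (holeRows Q₂ W j) := by
  induction j with
  | zero => rw [holeRows_zero, holeRows_zero, h]
  | succ j ih => rw [← tabKickers_pTableau_holeRows, ← tabKickers_pTableau_holeRows, ih]

theorem Slides.unique_of_pTableau_eq {S S₁ S₂ : SkewTableau} {Q₁ Q₁' Q₂ Q₂' : List ℕ}
    (h1 : Slides S Q₁ Q₁' S₁) (h2 : Slides S Q₂ Q₂' S₂) (h : pTableau Q₁ = pTableau Q₂) :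
    S₁ = S₂ ∧ pTableau Q₁' = pTableau Q₂' := by
  obtain ⟨a1, b1⟩ := h1.holeRows_eventually
  obtain ⟨a2, b2⟩ := h2.holeRows_eventually
  constructor
  · apply SkewTableau.ext_wMatrix
    rw [← a1, ← a2, ← arrayW_pTableau, ← arrayW_pTableau, h]
  · obtain ⟨j, hj1, hj2⟩ := (b1.and b2).exists
    rw [← hj1, ← hj2, pTableau_holeRows_congr h]

/-! ### The matrix equation -/

theorem matE_apply (p : ℕ) (a x : ℕ → ℝ) (i : ℕ) :
    matE p a x i = if i < p then x i else a i * x i + x (i + 1) := rfl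

theorem matF_zero (v x : ℕ → ℝ) : matF v x 0 = x 0 := rfl

theorem matF_succ (v x : ℕ → ℝ) (i : ℕ) : matF v x (i + 1) = x (i + 1) - v i * x i := rfl

/-- The first component of the solution `(J', V')` of `F(V') E_p(J) = E_p(J') F(V)`. -/
noncomputable def stepE (p : ℕ) (J V : ℕ → ℝ) (i : ℕ) : ℝ :=
  if i < p then 1 else if i = p then J i + V i
    else (J i + V i) * J (i - 1) / (J (i - 1) + V (i - 1))

/-- The second component of the solution `(J', V')` of `F(V') E_p(J) = E_p(J') F(V)`. -/
noncomputable def stepF (p : ℕ) (J V : ℕ → ℝ) (i : ℕ) : ℝ :=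
  if i + 1 < p then V i else if i + 1 = p then (J (i + 1) + V (i + 1)) * V i
    else (J (i + 1) + V (i + 1)) * V i / (J i + V i)

theorem stepE_pos (p : ℕ) {J V : ℕ → ℝ} (hJ : ∀ i, 0 < J i) (hV : ∀ i, 0 < V i) (i : ℕ) :
    0 < stepE p J V i := by
  have h1 := hJ i
  have h2 := hV i
  have h3 := hJ (i - 1)
  have h4 := hV (i - 1)
  unfold stepE
  split_ifs <;> positivity

theorem stepF_pos (p : ℕ) {J V : ℕ → ℝ} (hJ : ∀ i, 0 < J i) (hV : ∀ i, 0 < V i) (i : ℕ) :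
    0 < stepF p J V i := by
  have h1 := hJ i
  have h2 := hV i
  have h3 := hJ (i + 1)
  have h4 := hV (i + 1)
  unfold stepF
  split_ifs <;> positivity

/-- For `i ≥ p`, comparing entries in row `i + 1` gives `J' (i+1) + V' i = J (i+1) + V (i+1)` and
`V' i * J i = J' (i+1) * V i`, whose solution is `stepE`, `stepF`. The first rows, up to `p`, give
the special cases. -/
theorem matF_mul_matE (p : ℕ) {J V : ℕ → ℝ} (hJ : ∀ i, 0 < J i) (hV : ∀ i, 0 < V i) :
    matF (stepF p J V) * matE p J = matE p (stepE p J V) * matF V := by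
  refine LinearMap.ext fun x => funext fun i => ?_
  rw [Module.End.mul_apply, Module.End.mul_apply]
  rcases i with _ | i
  · rw [matF_zero, matE_apply, matE_apply, matF_zero, matF_succ]
    by_cases h : 0 < p
    · rw [if_pos h, if_pos h]
    · rw [if_neg h, if_neg h, stepE, if_neg h, if_pos (by omega)]
      ring
  · rw [matF_succ, matE_apply, matE_apply, matE_apply, matF_succ, matF_succ]
    rcases lt_trichotomy (i + 1) p with h | h | h
    · rw [if_pos h, if_pos h, if_pos (by omega), stepF, if_pos h]
    · have h1 : ¬ i + 1 < p := h.not_lt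
      rw [if_neg h1, if_neg h1, if_pos (by omega), stepF, if_neg h1, if_pos h, stepE, if_neg h1,
        if_pos h]
      ring
    · have h1 : J i + V i ≠ 0 := (add_pos (hJ i) (hV i)).ne'
      rw [if_neg (by omega), if_neg (by omega), if_neg (by omega), stepF, if_neg (by omega),
        if_neg (by omega), stepE, if_neg (by omega), if_neg (by omega), Nat.add_sub_cancel]
      field_simp
      ring

/-- The vector part of the rational map. -/
noncomputable def ratV (J : ℕ → ℕ → ℝ) : ℕ → (ℕ → ℝ) → ℕ → ℝ
  | 0, V => V
  | k + 1, V => ratV J k (stepF k (J k) V)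

/-- The array part of the rational map. -/
noncomputable def ratJ (J : ℕ → ℕ → ℝ) : ℕ → (ℕ → ℝ) → ℕ → ℕ → ℝ
  | 0, _ => J
  | k + 1, V => Function.update (ratJ J k (stepF k (J k) V)) k (stepE k (J k) V)

theorem isPosData_rat {J : ℕ → ℕ → ℝ} (hJ : ∀ p i, 0 < J p i) (k : ℕ) {V : ℕ → ℝ}
    (hV : ∀ i, 0 < V i) : IsPosData (fun p : Fin k => ratJ J k V p) (ratV J k V) := by
  have key : (∀ p < k, ∀ i, 0 < ratJ J k V p i) ∧ (∀ p < k, ∀ i < p, ratJ J k V p i = 1) ∧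
      ∀ i, 0 < ratV J k V i := by
    induction k generalizing V with
    | zero => exact ⟨fun p hp => absurd hp (by omega), fun p hp => absurd hp (by omega), hV⟩
    | succ k ih =>
      obtain ⟨h1, h2, h3⟩ := ih (stepF_pos k (hJ k) hV)
      refine ⟨fun p hp i => ?_, fun p hp i hi => ?_, h3⟩
      · rcases (Nat.lt_succ_iff.1 hp).lt_or_eq with h | rfl
        · rw [ratJ, Function.update_of_ne h.ne]
          exact h1 p h i
        · rw [ratJ, Function.update_self]
          exact stepE_pos p (hJ p) hV i
      · rcases (Nat.lt_succ_iff.1 hp).lt_or_eq with h | rfl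
        · rw [ratJ, Function.update_of_ne h.ne]
          exact h2 p h i hi
        · rw [ratJ, Function.update_self, stepE, if_pos hi]
  exact ⟨fun p => key.1 p p.2, fun p => key.2.1 p p.2, key.2.2⟩

/-- `F(V)` stands on the right and is moved leftwards through the product, so it meets the factor
with the largest index first, as in the column map. -/
theorem todaEquation_rat {J : ℕ → ℕ → ℝ} (hJ : ∀ p i, 0 < J p i) (k : ℕ) {V : ℕ → ℝ}
    (hV : ∀ i, 0 < V i) :
    TodaEquation (fun p : Fin k => J p) V (fun p => ratJ J k V p) (ratV J k V) := by
  induction k generalizing V with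
  | zero => simp [TodaEquation, ratV]
  | succ k ih =>
    have h := ih (stepF_pos k (hJ k) hV)
    unfold TodaEquation at h ⊢
    rw [List.ofFn_succ', List.ofFn_succ', List.prod_concat, List.prod_concat]
    simp only [Fin.val_castSucc, Fin.val_last, ratV, ratJ, Function.update_self]
    have e : ∀ p : Fin k, Function.update (ratJ J k (stepF k (J k) V)) k (stepE k (J k) V) p =
        ratJ J k (stepF k (J k) V) p := fun p => Function.update_of_ne p.2.ne _ _
    simp only [e]
    rw [← mul_assoc, h, mul_assoc, matF_mul_matE k (hJ k) hV, mul_assoc]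

/-- The product `E_s(J_0) E_{s+1}(J_1) ⋯ E_{s+k-1}(J_{k-1})`. -/
def prodE (s : ℕ) {k : ℕ} (J : Fin k → ℕ → ℝ) : Module.End ℝ (ℕ → ℝ) :=
  (List.ofFn fun p : Fin k => matE (s + p) (J p)).prod

theorem prodE_zero (s : ℕ) (J : Fin 0 → ℕ → ℝ) : prodE s J = 1 := by
  simp [prodE]

theorem prodE_succ (s : ℕ) {k : ℕ} (J : Fin (k + 1) → ℕ → ℝ) :
    prodE s J = matE s (J 0) * prodE (s + 1) fun p => J p.succ := by
  simp only [prodE, List.ofFn_succ, List.prod_cons, Fin.val_zero, Fin.val_succ, add_zero]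
  congr 4
  funext p
  congr 1
  omega

theorem prodE_apply_of_lt {s k : ℕ} (J : Fin k → ℕ → ℝ) (x : ℕ → ℝ) {i : ℕ} (hi : i < s) :
    prodE s J x i = x i := by
  induction k generalizing s with
  | zero => rw [prodE_zero, Module.End.one_apply]
  | succ k ih =>
    rw [prodE_succ, Module.End.mul_apply, matE_apply, if_pos hi, ih _ (by omega)]

theorem prodE_upper {s k : ℕ} (J : Fin k → ℕ → ℝ) {x : ℕ → ℝ} {n : ℕ}
    (hx : ∀ m, n ≤ m → x m = 0) : ∀ m, n ≤ m → prodE s J x m = 0 := by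
  induction k generalizing s with
  | zero => rwa [prodE_zero]
  | succ k ih =>
    intro m hm
    rw [prodE_succ, Module.End.mul_apply, matE_apply, ih _ m hm, ih _ (m + 1) (by omega)]
    simp

theorem prodE_single_succ {s k : ℕ} (J : Fin k → ℕ → ℝ) (i : ℕ) :
    prodE s J (Pi.single i 1) (i + 1) = 0 :=
  prodE_upper J (n := i + 1) (fun m hm => Pi.single_eq_of_ne (by omega) _) _ le_rfl

theorem prodE_single_pos {s k : ℕ} {J : Fin k → ℕ → ℝ} (hJ : ∀ p i, 0 < J p i) (i : ℕ) :
    0 < prodE s J (Pi.single i 1) i := by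
  induction k generalizing s with
  | zero =>
    rw [prodE_zero, Module.End.one_apply, Pi.single_eq_same]
    exact one_pos
  | succ k ih =>
    have h := ih (s := s + 1) (J := fun p => J p.succ) fun p => hJ p.succ
    rw [prodE_succ, Module.End.mul_apply, matE_apply, prodE_single_succ, add_zero]
    split_ifs
    · exact h
    · exact mul_pos (hJ 0 i) h

theorem prodE_nonneg {s k : ℕ} {J : Fin k → ℕ → ℝ} (hJ : ∀ p i, 0 < J p i) {x : ℕ → ℝ}
    (hx : ∀ i, 0 ≤ x i) (i : ℕ) : 0 ≤ prodE s J x i := by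
  induction k generalizing s i with
  | zero =>
    rw [prodE_zero]
    exact hx i
  | succ k ih =>
    have h := fun i => ih (s := s + 1) (J := fun p => J p.succ) (fun p => hJ p.succ) i
    rw [prodE_succ, Module.End.mul_apply, matE_apply]
    split_ifs
    · exact h i
    · exact add_nonneg (mul_nonneg (hJ 0 i).le (h i)) (h (i + 1))

/-- Write the product as `E_s(a) B`. Row `i ≥ s` of it is `a i` times row `i` of `B` plus row `i +
1` of `B`. Rows up to `s` of `B` are those of the identity. Once row `i` of `B` is known, its
positive diagonal entry yields `a i`, and then row `i + 1` of `B` follows. Induction on the number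
of factors treats `B`. -/
theorem prodE_injective {s k : ℕ} {J J' : Fin k → ℕ → ℝ} (hJ : ∀ p i, 0 < J p i)
    (h1 : ∀ (p : Fin k) i, i < s + p → J p i = 1)
    (h1' : ∀ (p : Fin k) i, i < s + p → J' p i = 1) (h : prodE s J = prodE s J') : J = J' := by
  induction k generalizing s with
  | zero => exact Subsingleton.elim _ _
  | succ k ih =>
    rw [prodE_succ, prodE_succ] at h
    have h' : ∀ x i, matE s (J 0) (prodE (s + 1) (fun p => J p.succ) x) i =
        matE s (J' 0) (prodE (s + 1) (fun p => J' p.succ) x) i := fun x i => by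
      rw [← Module.End.mul_apply, h, Module.End.mul_apply]
    simp only [matE_apply] at h'
    have hd : ∀ i, s ≤ i → (∀ x, prodE (s + 1) (fun p => J p.succ) x i =
        prodE (s + 1) (fun p => J' p.succ) x i) → J 0 i = J' 0 i := by
      intro i hi hB
      have h2 := h' (Pi.single i 1) i
      rw [if_neg (not_lt.2 hi), if_neg (not_lt.2 hi), prodE_single_succ, prodE_single_succ, ← hB,
        add_zero, add_zero] at h2
      exact mul_right_cancel₀ (prodE_single_pos (fun p => hJ p.succ) i).ne' h2
    have hB : ∀ i, ∀ x, prodE (s + 1) (fun p => J p.succ) x i =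
        prodE (s + 1) (fun p => J' p.succ) x i := by
      intro i
      induction i with
      | zero =>
        intro x
        rw [prodE_apply_of_lt _ _ (by omega), prodE_apply_of_lt _ _ (by omega)]
      | succ i ihi =>
        intro x
        by_cases hi : i < s
        · rw [prodE_apply_of_lt _ _ (by omega), prodE_apply_of_lt _ _ (by omega)]
        · have h2 := h' x i
          rw [if_neg hi, if_neg hi, hd i (not_lt.1 hi) ihi, ihi x] at h2
          exact add_left_cancel h2
    have h2 : (fun p => J p.succ) = fun p : Fin k => J' p.succ :=
      ih (fun p => hJ p.succ)
        (fun p i hi => h1 p.succ i (by rw [Fin.val_succ]; omega))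
        (fun p i hi => h1' p.succ i (by rw [Fin.val_succ]; omega))
        (LinearMap.ext fun x => funext fun i => hB i x)
    funext p
    refine Fin.cases ?_ (fun p => congrFun h2 p) p
    funext i
    by_cases hi : i < s
    · rw [h1 0 i (by simpa using hi), h1' 0 i (by simpa using hi)]
    · exact hd i (not_lt.1 hi) (hB i)

/-- The solution `x` of `F(v) x = y`. -/
def solveF (v y : ℕ → ℝ) : ℕ → ℝ
  | 0 => y 0
  | i + 1 => y (i + 1) + v i * solveF v y i

theorem matF_solveF (v y : ℕ → ℝ) : matF v (solveF v y) = y := by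
  funext i
  rcases i with _ | i
  · rfl
  · rw [matF_succ, solveF]
    ring

theorem nonneg_of_matF_nonneg {v y : ℕ → ℝ} (hv : ∀ i, 0 < v i) (h : ∀ i, 0 ≤ matF v y i) (i : ℕ) :
    0 ≤ y i := by
  induction i with
  | zero => exact h 0
  | succ i ih =>
    have h1 := h (i + 1)
    rw [matF_succ] at h1
    have h2 := mul_nonneg (hv i).le ih
    linarith

/-- The inverse of `F(v)` has non-negative entries and `1`'s on the diagonal. -/
theorem le_of_matF_nonneg {v y : ℕ → ℝ} (hv : ∀ i, 0 < v i) (h : ∀ i, 0 ≤ matF v y i) (i : ℕ) :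
    matF v y i ≤ y i := by
  rcases i with _ | i
  · exact le_rfl
  · rw [matF_succ]
    have h2 := mul_nonneg (hv i).le (nonneg_of_matF_nonneg hv h i)
    linarith

theorem TodaEquation.prodE_eq {k : ℕ} {J : Fin k → ℕ → ℝ} {V : ℕ → ℝ} {J' : Fin k → ℕ → ℝ}
    {V' : ℕ → ℝ} (h : TodaEquation J V J' V') :
    matF V' * prodE 0 J = prodE 0 J' * matF V := by
  simpa only [prodE, zero_add, TodaEquation] using h

/-- Applying the equation to the preimage of a unit vector under `F(V)` gives a vector `y`,
independent of the solution, for which `F(V') y` is a column of an upper triangular matrix. Hence `y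
(i+1) = V' i * y i`, and `y i > 0` by positivity, so `V'` is determined. Cancelling `F(V)` leaves
the uniqueness of the factorization. -/
theorem TodaEquation.unique {k : ℕ} {J : Fin k → ℕ → ℝ} {V : ℕ → ℝ} {J₁ J₂ : Fin k → ℕ → ℝ}
    {V₁ V₂ : ℕ → ℝ} (hp₁ : IsPosData J₁ V₁) (hp₂ : IsPosData J₂ V₂)
    (h₁ : TodaEquation J V J₁ V₁) (h₂ : TodaEquation J V J₂ V₂) : J₁ = J₂ ∧ V₁ = V₂ := by
  have e₁ := h₁.prodE_eq
  have e₂ := h₂.prodE_eq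
  have hV : V₁ = V₂ := by
    funext i
    set y := prodE 0 J (solveF V (Pi.single i 1)) with hy
    have f₁ : matF V₁ y = prodE 0 J₁ (Pi.single i 1) := by
      rw [hy, ← Module.End.mul_apply, e₁, Module.End.mul_apply, matF_solveF]
    have f₂ : matF V₂ y = prodE 0 J₂ (Pi.single i 1) := by
      rw [hy, ← Module.End.mul_apply, e₂, Module.End.mul_apply, matF_solveF]
    have hx : ∀ m, (0 : ℝ) ≤ (Pi.single i 1 : ℕ → ℝ) m := by
      intro m
      rw [Pi.single_apply]
      split_ifs <;> norm_num
    have hn : 0 < y i := by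
      refine lt_of_lt_of_le ?_ (le_of_matF_nonneg hp₁.2.2 (fun m => ?_) i)
      · rw [f₁]
        exact prodE_single_pos hp₁.1 i
      · rw [f₁]
        exact prodE_nonneg hp₁.1 hx m
    have g₁ := congrFun f₁ (i + 1)
    have g₂ := congrFun f₂ (i + 1)
    rw [prodE_single_succ, matF_succ] at g₁ g₂
    exact mul_right_cancel₀ hn.ne' (by linarith)
  refine ⟨?_, hV⟩
  refine prodE_injective (s := 0) hp₁.1 (fun p i hi => hp₁.2.1 p i (by omega))
    (fun p i hi => hp₂.2.1 p i (by omega)) ?_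
  refine LinearMap.ext fun x => ?_
  rw [← matF_solveF V x, ← Module.End.mul_apply, ← Module.End.mul_apply, ← e₁, ← e₂, hV]

/-- The extension of a finite array by rows of `1`'s. -/
noncomputable def extendArray {k : ℕ} (J : Fin k → ℕ → ℝ) (p : ℕ) : ℕ → ℝ :=
  if h : p < k then J ⟨p, h⟩ else 1

theorem extendArray_val {k : ℕ} (J : Fin k → ℕ → ℝ) (p : Fin k) : extendArray J p = J p := by
  simp [extendArray]

theorem extendArray_pos {k : ℕ} {J : Fin k → ℕ → ℝ} (h : ∀ p i, 0 < J p i) (p i : ℕ) :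
    0 < extendArray J p i := by
  unfold extendArray
  split_ifs with hp
  · exact h _ i
  · exact one_pos

theorem todaEquation_extendArray {k : ℕ} {J : Fin k → ℕ → ℝ} {V : ℕ → ℝ} (h : IsPosData J V) :
    TodaEquation J V (fun p => ratJ (extendArray J) k V p) (ratV (extendArray J) k V) := by
  have := todaEquation_rat (extendArray_pos h.1) k h.2.2
  simpa only [extendArray_val] using this

theorem existsUnique_toda {k : ℕ} {J : Fin k → ℕ → ℝ} {V : ℕ → ℝ} (h : IsPosData J V) :
    ∃! R : (Fin k → ℕ → ℝ) × (ℕ → ℝ), IsPosData R.1 R.2 ∧ TodaEquation J V R.1 R.2 := by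
  have hp := isPosData_rat (extendArray_pos h.1) k h.2.2
  have he := todaEquation_extendArray h
  refine ⟨(_, _), ⟨hp, he⟩, ?_⟩
  rintro ⟨J', V'⟩ ⟨h1, h2⟩
  obtain ⟨rfl, rfl⟩ := TodaEquation.unique h1 hp h2 he
  rfl

/-! ### Tropicalization -/

theorem HasTrop.congr {f g : ℝ → ℝ} {A B : ℝ} (h : HasTrop f A) (hfg : ∀ ε, 0 < ε → f ε = g ε)
    (hAB : A = B) : HasTrop g B := by
  subst hAB
  refine Filter.Tendsto.congr' ?_ h
  filter_upwards [self_mem_nhdsWithin] with ε hε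
  rw [hfg ε hε]

theorem hasTrop_one : HasTrop (fun _ => 1) 0 := by
  simp [HasTrop]

theorem HasTrop.unique {f : ℝ → ℝ} {A B : ℝ} (h : HasTrop f A) (h' : HasTrop f B) : A = B :=
  tendsto_nhds_unique h h'

theorem HasTrop.mul {f g : ℝ → ℝ} {A B : ℝ} (hf : ∀ ε, 0 < ε → 0 < f ε)
    (hg : ∀ ε, 0 < ε → 0 < g ε) (h : HasTrop f A) (h' : HasTrop g B) :
    HasTrop (fun ε => f ε * g ε) (A + B) := by
  refine Filter.Tendsto.congr' ?_ (Filter.Tendsto.add h h')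
  filter_upwards [self_mem_nhdsWithin] with ε hε
  rw [Real.log_mul (hf ε hε).ne' (hg ε hε).ne']
  ring

theorem HasTrop.div {f g : ℝ → ℝ} {A B : ℝ} (hf : ∀ ε, 0 < ε → 0 < f ε)
    (hg : ∀ ε, 0 < ε → 0 < g ε) (h : HasTrop f A) (h' : HasTrop g B) :
    HasTrop (fun ε => f ε / g ε) (A - B) := by
  refine Filter.Tendsto.congr' ?_ (Filter.Tendsto.sub h h')
  filter_upwards [self_mem_nhdsWithin] with ε hε
  rw [Real.log_div (hf ε hε).ne' (hg ε hε).ne']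
  ring

/-- The sum lies between the maximum of `f` and `g` and twice this maximum, and `ε * log 2` tends to
`0`; the minus sign turns the maximum into a minimum. -/
theorem HasTrop.add {f g : ℝ → ℝ} {A B : ℝ} (hf : ∀ ε, 0 < ε → 0 < f ε)
    (hg : ∀ ε, 0 < ε → 0 < g ε) (h : HasTrop f A) (h' : HasTrop g B) :
    HasTrop (fun ε => f ε + g ε) (min A B) := by
  have hm := Filter.Tendsto.min h h'
  have h0 : Filter.Tendsto (fun ε : ℝ => ε * Real.log 2) (nhdsWithin 0 (Set.Ioi 0)) (nhds 0) := by
    have : Filter.Tendsto (fun ε : ℝ => ε * Real.log 2) (nhds 0) (nhds (0 * Real.log 2)) :=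
      Filter.tendsto_id.mul_const _
    rw [zero_mul] at this
    exact this.mono_left nhdsWithin_le_nhds
  have hl := hm.sub h0
  rw [sub_zero] at hl
  have key : ∀ ε, 0 < ε →
      min (-(ε * Real.log (f ε))) (-(ε * Real.log (g ε))) - ε * Real.log 2 ≤
        -(ε * Real.log (f ε + g ε)) ∧
      -(ε * Real.log (f ε + g ε)) ≤ min (-(ε * Real.log (f ε))) (-(ε * Real.log (g ε))) := by
    intro ε hε
    have hf' := hf ε hε
    have hg' := hg ε hε
    have u1 : Real.log (f ε) ≤ Real.log (f ε + g ε) := Real.log_le_log hf' (by linarith)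
    have u2 : Real.log (g ε) ≤ Real.log (f ε + g ε) := Real.log_le_log hg' (by linarith)
    have u3 : Real.log (f ε + g ε) ≤ Real.log 2 + max (Real.log (f ε)) (Real.log (g ε)) := by
      rcases le_total (f ε) (g ε) with hle | hle
      · refine (Real.log_le_log (by linarith) (by linarith : f ε + g ε ≤ 2 * g ε)).trans ?_
        rw [Real.log_mul two_ne_zero hg'.ne']
        linarith [le_max_right (Real.log (f ε)) (Real.log (g ε))]
      · refine (Real.log_le_log (by linarith) (by linarith : f ε + g ε ≤ 2 * f ε)).trans ?_
        rw [Real.log_mul two_ne_zero hf'.ne']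
        linarith [le_max_left (Real.log (f ε)) (Real.log (g ε))]
    have v1 := mul_le_mul_of_nonneg_left u1 hε.le
    have v2 := mul_le_mul_of_nonneg_left u2 hε.le
    have v3 := mul_le_mul_of_nonneg_left u3 hε.le
    rw [mul_add] at v3
    constructor
    · rcases max_cases (Real.log (f ε)) (Real.log (g ε)) with ⟨e, -⟩ | ⟨e, -⟩
      · rw [e] at v3
        linarith [min_le_left (-(ε * Real.log (f ε))) (-(ε * Real.log (g ε)))]
      · rw [e] at v3
        linarith [min_le_right (-(ε * Real.log (f ε))) (-(ε * Real.log (g ε)))]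
    · exact le_min (by linarith) (by linarith)
  refine tendsto_of_tendsto_of_tendsto_of_le_of_le' hl hm ?_ ?_
  · filter_upwards [self_mem_nhdsWithin] with ε hε using (key ε hε).1
  · filter_upwards [self_mem_nhdsWithin] with ε hε using (key ε hε).2

section Step

variable {p : ℕ} {P W : ℕ → ℕ} {J V : ℝ → ℕ → ℝ} (hJ : ∀ ε, 0 < ε → ∀ i, 0 < J ε i)
  (hV : ∀ ε, 0 < ε → ∀ i, 0 < V ε i) (hP0 : ∀ i < p, P i = 0)
  (hP : ∀ i, HasTrop (fun ε => J ε i) (P i)) (hW : ∀ i, HasTrop (fun ε => V ε i) (W i))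
include hJ hV hP hW

theorem hasTrop_add_step (i : ℕ) :
    HasTrop (fun ε => J ε i + V ε i) ((min (P i) (W i) : ℕ) : ℝ) := by
  rw [Nat.cast_min]
  exact HasTrop.add (fun ε hε => hJ ε hε i) (fun ε hε => hV ε hε i) (hP i) (hW i)

include hP0

/-- The vanishing of `P` below `p` is what makes the uniform tropical rule agree with the special
cases of the rational one, where the value is `1` or a denominator is missing. -/
theorem hasTrop_stepE (i : ℕ) :
    HasTrop (fun ε => stepE p (J ε) (V ε) i) (kickers P W i : ℝ) := by
  have hs := hasTrop_add_step hJ hV hP hW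
  have hp : ∀ i ε, 0 < ε → 0 < J ε i + V ε i := fun i ε hε => add_pos (hJ ε hε i) (hV ε hε i)
  rcases lt_trichotomy i p with h | h | h
  · refine hasTrop_one.congr (fun ε _ => by rw [stepE, if_pos h]) ?_
    have h1 := hP0 i h
    rcases i with _ | i
    · simp [kickers, h1]
    · simp [kickers, h1, hP0 i (by omega)]
  · refine (hs i).congr (fun ε _ => by rw [stepE, if_neg (by omega), if_pos h]) ?_
    rcases i with _ | i
    · simp [kickers]
    · simp [kickers, hP0 i (by omega)]
  · rcases i with _ | i
    · omega
    · refine (HasTrop.div (fun ε hε => mul_pos (hp (i + 1) ε hε) (hJ ε hε i)) (hp i)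
        (HasTrop.mul (hp (i + 1)) (fun ε hε => hJ ε hε i) (hs (i + 1)) (hP i)) (hs i)).congr
        (fun ε _ => by
          rw [stepE, if_neg (by omega), if_neg (by omega), Nat.add_sub_cancel]) ?_
      rw [kickers, Nat.cast_add, Nat.cast_sub (min_le_left _ _)]
      ring

theorem hasTrop_stepF (i : ℕ) :
    HasTrop (fun ε => stepF p (J ε) (V ε) i) (balls P W i : ℝ) := by
  have hs := hasTrop_add_step hJ hV hP hW
  have hp : ∀ i ε, 0 < ε → 0 < J ε i + V ε i := fun i ε hε => add_pos (hJ ε hε i) (hV ε hε i)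
  rcases lt_trichotomy (i + 1) p with h | h | h
  · refine (hW i).congr (fun ε _ => by rw [stepF, if_pos h]) ?_
    simp [balls, hP0 i (by omega), hP0 (i + 1) h]
  · refine (HasTrop.mul (hp (i + 1)) (fun ε hε => hV ε hε i) (hs (i + 1)) (hW i)).congr
      (fun ε _ => by rw [stepF, if_neg (by omega), if_pos h]) ?_
    simp [balls, hP0 i (by omega), add_comm]
  · refine (HasTrop.div (fun ε hε => mul_pos (hp (i + 1) ε hε) (hV ε hε i)) (hp i)
      (HasTrop.mul (hp (i + 1)) (fun ε hε => hV ε hε i) (hs (i + 1)) (hW i)) (hs i)).congr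
      (fun ε _ => by rw [stepF, if_neg (by omega), if_neg (by omega)]) ?_
    rw [balls, Nat.cast_add, Nat.cast_sub (min_le_right _ _)]
    ring

end Step

theorem hasTrop_rat {k : ℕ} {P : ℕ → ℕ → ℕ} {W : ℕ → ℕ} {J : ℝ → ℕ → ℕ → ℝ} {V : ℝ → ℕ → ℝ}
    (hJ : ∀ ε, 0 < ε → ∀ p i, 0 < J ε p i) (hV : ∀ ε, 0 < ε → ∀ i, 0 < V ε i)
    (hP0 : ∀ p < k, ∀ i < p, P p i = 0)
    (hP : ∀ p < k, ∀ i, HasTrop (fun ε => J ε p i) (P p i))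
    (hW : ∀ i, HasTrop (fun ε => V ε i) (W i)) :
    (∀ p < k, ∀ i, HasTrop (fun ε => ratJ (J ε) k (V ε) p i) (colKickers P k W p i)) ∧
    ∀ i, HasTrop (fun ε => ratV (J ε) k (V ε) i) (colBalls P k W i) := by
  induction k generalizing V W with
  | zero => exact ⟨fun p hp => absurd hp (by omega), hW⟩
  | succ k ih =>
    have hk := Nat.lt_succ_self k
    have hJk : ∀ ε, 0 < ε → ∀ i, 0 < J ε k i := fun ε hε => hJ ε hε k
    obtain ⟨i1, i2⟩ := ih (V := fun ε => stepF k (J ε k) (V ε)) (W := balls (P k) W)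
      (fun ε hε => stepF_pos k (hJk ε hε) (hV ε hε))
      (fun p hp => hP0 p (by omega)) (fun p hp => hP p (by omega))
      (hasTrop_stepF hJk hV (hP0 k hk) (hP k hk) hW)
    refine ⟨fun p hp i => ?_, i2⟩
    simp only [ratJ, colKickers]
    rcases (Nat.lt_succ_iff.1 hp).lt_or_eq with h | rfl
    · simp only [Function.update_of_ne h.ne]
      exact i1 p h i
    · simp only [Function.update_self]
      exact hasTrop_stepE hJk hV (hP0 p hk) (hP p hk) hW i

theorem hasTrop_toda {k : ℕ} {P : ℕ → ℕ → ℕ} {W : ℕ → ℕ} {J J' : ℝ → Fin k → ℕ → ℝ}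
    {V V' : ℝ → ℕ → ℝ}
    (h : ∀ ε, 0 < ε → IsPosData (J ε) (V ε) ∧ IsPosData (J' ε) (V' ε) ∧
      TodaEquation (J ε) (V ε) (J' ε) (V' ε))
    (hP : ∀ (p : Fin k) (i : ℕ), HasTrop (fun ε => J ε p i) (P p i))
    (hW : ∀ i, HasTrop (fun ε => V ε i) (W i)) :
    (∀ (p : Fin k) (i : ℕ), HasTrop (fun ε => J' ε p i) (colKickers P k W p i)) ∧
    ∀ i, HasTrop (fun ε => V' ε i) (colBalls P k W i) := by
  have hs : ∀ ε, 0 < ε → J' ε = (fun p : Fin k => ratJ (extendArray (J ε)) k (V ε) p) ∧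
      V' ε = ratV (extendArray (J ε)) k (V ε) := fun ε hε =>
    TodaEquation.unique (h ε hε).2.1
      (isPosData_rat (extendArray_pos (h ε hε).1.1) k (h ε hε).1.2.2) (h ε hε).2.2
      (todaEquation_extendArray (h ε hε).1)
  obtain ⟨h1, h2⟩ := hasTrop_rat (k := k) (P := P) (W := W) (J := fun ε => extendArray (J ε)) (V := V)
    (fun ε hε => extendArray_pos (h ε hε).1.1) (fun ε hε => (h ε hε).1.2.2)
    -- The entries `1` to the left of the diagonal force the corresponding `P p i` to be `0`, by
    -- uniqueness of limits.
    (fun p hp i hi => by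
      have := (hP ⟨p, hp⟩ i).unique (hasTrop_one.congr
        (fun ε hε => ((h ε hε).1.2.1 ⟨p, hp⟩ i hi).symm) rfl)
      exact_mod_cast this)
    (fun p hp i => (hP ⟨p, hp⟩ i).congr
      (fun ε _ => by rw [← extendArray_val (J ε) ⟨p, hp⟩]) rfl) hW
  exact ⟨fun p i => (h1 p p.2 i).congr (fun ε hε => by rw [(hs ε hε).1]) rfl,
    fun i => (h2 i).congr (fun ε hε => by rw [(hs ε hε).2]) rfl⟩

end JeuDeTaquin

open JeuDeTaquin in
theorem mainTheorem2 :
    -- the slides prescribed by a sequence of inside corners can be carried out, in one way only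
    (∀ (S : SkewTableau) (Q : List ℕ), IsStartSequence S.inner Q →
      ∃! R : List ℕ × SkewTableau, Slides S Q R.1 R.2) ∧
    -- the commutative diagram
    (∀ (S S' : SkewTableau) (Q Q' : List ℕ), Slides S Q Q' S' →
      -- top arrow: the diagram of the tropical evolution computes the slides
      rectW Q S.wMatrix = S'.wMatrix ∧
      (∀ᶠ j in Filter.atTop, rectQ Q S.wMatrix j = Q'.map fun r => Pi.single r 1) ∧
      -- bottom arrow: applied to the `P`-tableau of `Q`, the tropical map gives that of `Q'`
      arrayW (pTableau Q).length (mult (pTableau Q)) S.wMatrix = S'.wMatrix ∧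
      (∀ᶠ j in Filter.atTop,
        arrayP (pTableau Q).length (mult (pTableau Q)) S.wMatrix j = mult (pTableau Q'))) ∧
    -- the result depends on `Q` only through its `P`-tableau
    (∀ (S S₁ S₂ : SkewTableau) (Q₁ Q₁' Q₂ Q₂' : List ℕ),
      Slides S Q₁ Q₁' S₁ → Slides S Q₂ Q₂' S₂ → pTableau Q₁ = pTableau Q₂ →
      S₁ = S₂ ∧ pTableau Q₁' = pTableau Q₂') ∧
    -- the matrix equation defines a map on positive data
    (∀ (k : ℕ) (J : Fin k → ℕ → ℝ) (V : ℕ → ℝ), IsPosData J V →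
      ∃! R : (Fin k → ℕ → ℝ) × (ℕ → ℝ), IsPosData R.1 R.2 ∧ TodaEquation J V R.1 R.2) ∧
    -- and the column map used in the bottom arrow is the tropicalization of this map
    (∀ (k : ℕ) (P : ℕ → ℕ → ℕ) (W : ℕ → ℕ)
      (J J' : ℝ → Fin k → ℕ → ℝ) (V V' : ℝ → ℕ → ℝ),
      (∀ ε, 0 < ε → IsPosData (J ε) (V ε) ∧ IsPosData (J' ε) (V' ε) ∧
        TodaEquation (J ε) (V ε) (J' ε) (V' ε)) →
      (∀ (p : Fin k) (i : ℕ), HasTrop (fun ε => J ε p i) (P p i)) →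
      (∀ i, HasTrop (fun ε => V ε i) (W i)) →
      (∀ (p : Fin k) (i : ℕ), HasTrop (fun ε => J' ε p i) (colKickers P k W p i)) ∧
      ∀ i, HasTrop (fun ε => V' ε i) (colBalls P k W i)) := by
  refine ⟨existsUnique_slides, fun S S' Q Q' h => ?_,
    fun S S₁ S₂ Q₁ Q₁' Q₂ Q₂' h1 h2 h => h1.unique_of_pTableau_eq h2 h,
    fun k J V h => existsUnique_toda h, fun k P W J J' V V' h hP hW => hasTrop_toda h hP hW⟩
  obtain ⟨h1, h2⟩ := h.holeRows_eventually
  refine ⟨h1, ?_, (arrayW_pTableau Q _).trans h1, ?_⟩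
  · filter_upwards [h2] with j hj
    rw [rectQ_eq, hj]
  · filter_upwards [h2] with j hj
    rw [arrayP_pTableau, hj]
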